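/- Consider a Markov decision process with finite non-empty state set $S$ and action set $A$: a sample of the pair $(s,a)$ consists of a reward $r$ and a next state $s'$, drawn from a fixed law with $s'\sim p(\cdot\mid s,a)$, $\mathbb E[r]=R(s,a)$ and $|r|\le R_{max}<\infty$ almost surely. Let $\gamma\in(0,1)$, and let $Q^*(s,a)=\max_{\pi:S\to A}\mathbb E\big[\sum_{i\ge0}\gamma^i r_i\mid s_0=s,\,a_0=a,\ a_i=\pi(s_i)\text{ for }i\ge1\big]$ be the optimal Q-values. *Synchronous Q-learning with experience replay*, with parameters $K\ge1$, $M\ge0$ and arbitrary initial values $Q_0$: the iterations $t=1,2,\dots$ come in rounds of $K$ online iterations followed by $M$ replay iterations. At an online iteration a fresh sample $(r,s')$ of every pair $(s,a)$ is drawn from the MDP and stored in the memory (the pair is then said to be *visited* at that iteration). At a replay iteration, for every pair $(s,a)$ one sample $(r,s')$ is drawn uniformly from all stored samples of that pair. All draws are independent. In both cases all pairs are updated simultaneously, $$Q_t(s,a)=(1-\alpha_t(s,a))\,Q_{t-1}(s,a)+\alpha_t(s,a)\big(r+\gamma\max_{a'}Q_{t-1}(s',a')\big),$$ where $\alpha_t(s,a)=1/n(s,a)$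 and $n(s,a)$ is the number of updates of $Q(s,a)$ up to and including iteration $t$ (so $n(s,a)=t$). Let $c\in(0,1)$ be such that, for every starting time $t\ge 0$, with probability at least $\tfrac12$ all state-action pairs are visited within the $|S||A|/c$ iterations that follow $t$. Let $\delta\in(0,1)$, let $V_{max}=R_{max}/(1-\gamma)$ and $0<\epsilon_1\le V_{max}$, and put $$\epsilon=\tfrac{1-\gamma}{2},\qquad D_0=V_{max}+\max(\|Q_0\|_\infty,V_{max}),\qquad N=\tfrac{2}{1-\gamma}\log\tfrac{D_0}{\epsilon_1},$$ $$B=3^{N}\cdot\frac{|S||A|\max(M,K)\,(R_{max}+\gamma V_{max})^2\,\log\frac{|S||A|N}{\delta}}{c\,\epsilon^2\epsilon_1^2\,(M+K)},\qquad C=B\cdot\log_2\tfrac1\delta .$$ There is a universal constant $\kappa>0$ (independent of the MDP and of all parameters above) such that for every integer $$T\ \ge\ \kappa\Big(B^2+\sqrt{B^4+B^2C}+C\Big),$$ with probability at least $1-\delta$ one has $\|Q_t-Q^*\|_\infty\le\epsilon_1$ for all $t\ge T$. -/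

import Mathlib

open MeasureTheory ProbabilityTheory

namespace SyncReplay

noncomputable section

/-- A (tabular) Markov decision process: `law s a` is the joint law of the reward and the next state
obtained when action `a` is taken in state `s`. -/
structure MDP (S A : Type*) [MeasurableSpace S] where
  law : S → A → Measure (ℝ × S)
  isProb : ∀ s a, IsProbabilityMeasure (law s a)

section Optimal

variable {S A : Type*} [MeasurableSpace S] [Fintype S]

/-- Transition probability `p(s' | s, a)`. -/
def MDP.P (D : MDP S A) (s : S) (a : A) (s' : S) : ℝ :=
  (D.law s a).real {x | x.2 = s'}

/-- Mean reward `R(s, a)`. -/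
def MDP.R (D : MDP S A) (s : S) (a : A) : ℝ := ∫ x, x.1 ∂(D.law s a)

/-- Expected reward of round `i` when round `0` starts in state `s` with action `a`, and the
policy `π` chooses the actions of all later rounds. -/
def MDP.expReward (D : MDP S A) (π : S → A) : ℕ → S → A → ℝ
  | 0, s, a => D.R s a
  | i + 1, s, a => ∑ s', D.P s a s' * MDP.expReward D π i s' (π s')

/-- Expected discounted return of `π`, after action `a` in state `s`. -/
def MDP.policyQ (D : MDP S A) (γ : ℝ) (π : S → A) (s : S) (a : A) : ℝ :=
  ∑' i : ℕ, γ ^ i * D.expReward π i s a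

/-- The optimal Q-values. -/
def MDP.optQ (D : MDP S A) (γ : ℝ) (s : S) (a : A) : ℝ :=
  ⨆ π : S → A, D.policyQ γ π s a

end Optimal

section Algorithm

/-- Iterations are numbered from `0`. They come in rounds of `K` online iterations followed by
`M` replay iterations. -/
abbrev IsOnline (K M k : ℕ) : Prop := k % (K + M) < K

/-- The memory before iteration `k`. Every online iteration `i` stores, for each state-action pair,
the transition that it sampled for that pair; that entry is represented by its index `i`. -/
def memory (K M k : ℕ) : Finset ℕ := (Finset.range k).filter (IsOnline K M)

variable {S A Ω : Type*}

/-- The experience (reward, next state) used to update the pair `(s, a)` at iteration `k`: the fresh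
sample `X k s a` if the iteration is online, otherwise the stored sample with index `J k s a`. -/
def experience (K M : ℕ) (X : ℕ → S → A → ℝ × S) (J : ℕ → S → A → ℕ) (k : ℕ) (s : S) (a : A) :
    ℝ × S :=
  if IsOnline K M k then X k s a else X (J k s a) s a

/-- The Q-values after a number of iterations, given the experience `z k s a` used at iteration `k`
for the pair `(s, a)`. All pairs are updated at every iteration, so that the number `n(s, a)` of
updates up to and including iteration `k` is `k + 1`; the learning rate is `1 / n(s, a)`. -/
def qValues (γ : ℝ) (Q₀ : S → A → ℝ) (z : ℕ → S → A → ℝ × S) : ℕ → S → A → ℝ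
  | 0 => Q₀
  | k + 1 => fun s a =>
      (1 - 1 / ((k : ℝ) + 1)) * qValues γ Q₀ z k s a
        + 1 / ((k : ℝ) + 1) * ((z k s a).1 + γ * ⨆ a' : A, qValues γ Q₀ z k (z k s a).2 a')

/-- The randomness of synchronous Q-learning with replay: `X k s a` is a sample of the reward and
the next state of `(s, a)`, and at a replay iteration `J k s a` is uniformly distributed on the
memory. All these draws are independent. -/
structure IsSampling [MeasurableSpace S] [MeasurableSpace Ω] (D : MDP S A) (K M : ℕ)
    (μ : Measure Ω) (X : ℕ → S → A → Ω → ℝ × S) (J : ℕ → S → A → Ω → ℕ) : Prop where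
  measurable_X : ∀ k s a, Measurable (X k s a)
  measurable_J : ∀ k s a, Measurable (J k s a)
  law_X : ∀ k s a, μ.map (X k s a) = D.law s a
  law_J : ∀ k, ¬ IsOnline K M k → ∀ s a, ∀ j ∈ memory K M k,
    μ.real {ω | J k s a ω = j} = 1 / ((memory K M k).card : ℝ)
  indep : iIndepFun (fun (p : ℕ × S × A) (ω : Ω) =>
    (X p.1 p.2.1 p.2.2 ω, J p.1 p.2.1 p.2.2 ω)) μ
  indep_XJ : ∀ k s a, IndepFun (X k s a) (J k s a) μ

/-- The Q-values of synchronous Q-learning with replay after `t` iterations. -/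
def syncQ (γ : ℝ) (K M : ℕ) (Q₀ : S → A → ℝ) (X : ℕ → S → A → Ω → ℝ × S)
    (J : ℕ → S → A → Ω → ℕ) (t : ℕ) (ω : Ω) : S → A → ℝ :=
  qValues γ Q₀ (experience K M (fun k s a => X k s a ω) (fun k s a => J k s a ω)) t

/-- The event that the pair `(s, a)` is visited at iteration `k`: a transition of it is
sampled from the MDP at that iteration and enters the memory. -/
def visited (K M k : ℕ) (_ : S) (_ : A) : Set Ω := {_ω | k ∈ memory K M (k + 1)}

/-- With probability at least `1/2`, from any starting time `t` on, all state-action pairs are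
visited within `|S||A| / c` iterations; `vis i s a` is the event that `(s, a)` is visited at
iteration `i`. -/
def CoveredWithProbHalf [Fintype S] [Fintype A] [MeasurableSpace Ω] (μ : Measure Ω)
    (vis : ℕ → S → A → Set Ω) (c : ℝ) : Prop :=
  ∀ t : ℕ, 1 / 2 ≤ μ.real {ω | ∀ s a, ∃ i : ℕ, t ≤ i ∧
    (i : ℝ) + 1 ≤ t + (Fintype.card S : ℝ) * Fintype.card A / c ∧ ω ∈ vis i s a}

end Algorithm

section Bound

/-- `V_max`. -/
def Vmax (γ Rmax : ℝ) : ℝ := Rmax / (1 - γ)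

/-- `D_0 = V_max + max (‖Q_0‖_∞) V_max`, as a function of `q = ‖Q_0‖_∞`. -/
def D₀ (γ Rmax q : ℝ) : ℝ := Vmax γ Rmax + max q (Vmax γ Rmax)

/-- `N = 2 / (1 - γ) * log (D_0 / ε₁)`. -/
def stages (γ Rmax q ε₁ : ℝ) : ℝ := 2 / (1 - γ) * Real.log (D₀ γ Rmax q / ε₁)

/-- The quantity `B`, where `n = |S||A|`, `q = ‖Q_0‖_∞` and `ε = (1 - γ) / 2`. -/
def boundB (n M K : ℕ) (γ c Rmax q ε₁ δ : ℝ) : ℝ :=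
  (3 : ℝ) ^ stages γ Rmax q ε₁ *
    ((n * max (M : ℝ) K * (Rmax + γ * Vmax γ Rmax) ^ 2
        * Real.log (n * stages γ Rmax q ε₁ / δ))
      / (c * ((1 - γ) / 2) ^ 2 * ε₁ ^ 2 * (M + K)))

/-- The quantity `C`. -/
def boundC (n M K : ℕ) (γ c Rmax q ε₁ δ : ℝ) : ℝ :=
  (3 : ℝ) ^ stages γ Rmax q ε₁ *
    ((n * max (M : ℝ) K * (Rmax + γ * Vmax γ Rmax) ^ 2
        * Real.log (n * stages γ Rmax q ε₁ / δ))
      / (c * ((1 - γ) / 2) ^ 2 * ε₁ ^ 2 * (M + K)) * Real.logb 2 (1 / δ))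

end Bound

end

end SyncReplay

/-!
Since the learning rates are `1 / n`, the Q-values after `t` updates are the averages of the first `t`
update targets (`mul_qValues_eq_sum`). Put the optimal Q-values into these targets: the change is at
most `γ` times the earlier error, and what remains is, by the Bellman equation `MDP.optQ_eq`, a
centred function of the sample, the `noise`, which does not depend on the current Q-values. So the
error `u t` satisfies `t * u t ≤ t * η + γ * ∑ i < t, u i` as soon as the averaged noise is at most `η`
(`mul_norm_qValues_sub_le`), and such a sequence approaches `η / (1 - γ)` at the rate
`t ^ (-(1 - γ))` (`le_of_averaged_contraction`). With `η = ε₁ * (1 - γ) / 2`, a noise that is small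
from time `t₀` on gives an error of at most `ε₁` from time `exp N * (t₀ + 1)` on.

The noise of the first `t` iterations is the sum of that of the fresh samples, of the deviations of
the replayed samples from the means of the memories they are drawn from, and of these means
(`abs_sum_experience_le`). Fresh samples are independent, so that Hoeffding's inequality bounds the
first part and every memory mean; the memory holds a fraction `1 / (M + 1)` of the past
(`le_mul_card_memory`). For the second part all fresh samples are frozen, by Fubini's theorem, and
Hoeffding's inequality is applied to the uniform draws (`measure_replay_sum_le`). Summing over all
times costs a geometric series (`measure_exists_deviation_le`).

Coverage forces `M + 1 ≤ n / c` for `n` the number of pairs. So the time `k₀` from which all deviations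
are small is of order `g * log (g * n / δ)` with `g = (n / c) * (Vmax / η) ^ 2`, and the first `k₀`
memory means, which are only bounded, are negligible from `t₀ = 8 * (Vmax / η) * k₀` on. Since
`Vmax / η ≤ √g`, this is at most a constant times `(g * L) ^ 2`, where `L` is the logarithm in `B`, and
`B ≥ 3 ^ N * (g * L) / 2`; hence `exp N * (t₀ + 1)` is at most a constant times `B ^ 2`
(`exists_burnIn`).
-/

namespace SyncReplay

/-! ### The Bellman equation for the optimal Q-values -/

lemma abs_iSup_sub_iSup_le {A : Type*} [Finite A] [Nonempty A] {f g : A → ℝ} {d : ℝ}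
    (h : ∀ a, |f a - g a| ≤ d) : |(⨆ a, f a) - ⨆ a, g a| ≤ d := by
  have hf : BddAbove (Set.range f) := (Set.finite_range f).bddAbove
  have hg : BddAbove (Set.range g) := (Set.finite_range g).bddAbove
  have h1 : (⨆ a, f a) ≤ (⨆ a, g a) + d := ciSup_le fun a => by
    have := le_ciSup hg a
    have := (abs_le.1 (h a)).2
    linarith
  have h2 : (⨆ a, g a) ≤ (⨆ a, f a) + d := ciSup_le fun a => by
    have := le_ciSup hf a
    have := (abs_le.1 (h a)).1
    linarith
  exact abs_le.2 ⟨by linarith, by linarith⟩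

lemma abs_iSup_le {A : Type*} [Finite A] [Nonempty A] {f : A → ℝ} {d : ℝ}
    (h : ∀ a, |f a| ≤ d) : |⨆ a, f a| ≤ d := by
  have := abs_iSup_sub_iSup_le (f := f) (g := fun _ => 0) (d := d) (by simpa using h)
  simpa using this

lemma abs_apply_apply_le_norm {S A : Type*} [Fintype S] [Fintype A] (Q : S → A → ℝ)
    (s : S) (a : A) : |Q s a| ≤ ‖Q‖ :=
  (norm_le_pi_norm (Q s) a).trans (norm_le_pi_norm Q s)

lemma norm_le_of_forall_abs_le {S A : Type*} [Fintype S] [Fintype A] {Q : S → A → ℝ} {d : ℝ}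
    (hd : 0 ≤ d) (h : ∀ s a, |Q s a| ≤ d) : ‖Q‖ ≤ d :=
  (pi_norm_le_iff_of_nonneg hd).2 fun s => (pi_norm_le_iff_of_nonneg hd).2 fun a => h s a

section

variable {S A : Type*} [MeasurableSpace S] (D : MDP S A)

lemma MDP.P_nonneg (s : S) (a : A) (s' : S) : 0 ≤ D.P s a s' := measureReal_nonneg

lemma MDP.abs_R_le {Rmax : ℝ} {s : S} {a : A} (h : ∀ᵐ x ∂(D.law s a), |x.1| ≤ Rmax) :
    |D.R s a| ≤ Rmax := by
  have := D.isProb s a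
  have h' := norm_integral_le_of_norm_le_const (f := fun x : ℝ × S => x.1) (C := Rmax) h
  simpa [MDP.R] using h'

lemma MDP.integrable_fst {Rmax : ℝ} {s : S} {a : A} (h : ∀ᵐ x ∂(D.law s a), |x.1| ≤ Rmax) :
    Integrable (fun x => x.1) (D.law s a) := by
  have := D.isProb s a
  exact Integrable.of_bound measurable_fst.aestronglyMeasurable Rmax h

variable [Fintype S] [MeasurableSingletonClass S]

lemma MDP.integral_comp_snd (s : S) (a : A) (V : S → ℝ) :
    ∫ x, V x.2 ∂(D.law s a) = ∑ s', D.P s a s' * V s' := by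
  have := D.isProb s a
  have := Measure.isProbabilityMeasure_map (μ := D.law s a)
    (measurable_snd (α := ℝ) (β := S)).aemeasurable
  rw [← integral_map (φ := Prod.snd) (f := V) measurable_snd.aemeasurable
    (Measurable.of_discrete.aestronglyMeasurable), integral_fintype Integrable.of_finite]
  refine Finset.sum_congr rfl fun s' _ => ?_
  rw [map_measureReal_apply measurable_snd (measurableSet_singleton s'), smul_eq_mul]
  rfl

lemma MDP.sum_P (s : S) (a : A) : ∑ s', D.P s a s' = 1 := by
  have := D.isProb s a
  simpa using (D.integral_comp_snd s a fun _ => 1).symm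

lemma MDP.abs_sum_P_mul_le (s : S) (a : A) {V : S → ℝ} {d : ℝ} (h : ∀ s', |V s'| ≤ d) :
    |∑ s', D.P s a s' * V s'| ≤ d := by
  calc |∑ s', D.P s a s' * V s'| ≤ ∑ s', D.P s a s' * d := by
        refine (Finset.abs_sum_le_sum_abs _ _).trans (Finset.sum_le_sum fun s' _ => ?_)
        rw [abs_mul, abs_of_nonneg (D.P_nonneg s a s')]
        exact mul_le_mul_of_nonneg_left (h s') (D.P_nonneg s a s')
    _ = d := by rw [← Finset.sum_mul, D.sum_P, one_mul]

variable {γ Rmax : ℝ}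

lemma MDP.abs_expReward_le (hr : ∀ s a, ∀ᵐ x ∂(D.law s a), |x.1| ≤ Rmax) (π : S → A) (i : ℕ) :
    ∀ s a, |D.expReward π i s a| ≤ Rmax := by
  induction i with
  | zero => exact fun s a => D.abs_R_le (hr s a)
  | succ i ih => exact fun s a => D.abs_sum_P_mul_le s a fun s' => ih s' (π s')

lemma MDP.summable_expReward (hr : ∀ s a, ∀ᵐ x ∂(D.law s a), |x.1| ≤ Rmax) (h0 : 0 < γ)
    (h1 : γ < 1) (π : S → A) (s : S) (a : A) :
    Summable fun i : ℕ => γ ^ i * D.expReward π i s a := by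
  refine Summable.of_norm_bounded
    ((summable_geometric_of_lt_one h0.le h1).mul_right Rmax) fun i => ?_
  rw [norm_mul, Real.norm_of_nonneg (pow_nonneg h0.le i)]
  exact mul_le_mul_of_nonneg_left (D.abs_expReward_le hr π i s a) (pow_nonneg h0.le i)

lemma MDP.policyQ_eq (hr : ∀ s a, ∀ᵐ x ∂(D.law s a), |x.1| ≤ Rmax) (h0 : 0 < γ)
    (h1 : γ < 1) (π : S → A) (s : S) (a : A) :
    D.policyQ γ π s a = D.R s a + γ * ∑ s', D.P s a s' * D.policyQ γ π s' (π s') := by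
  have hs := D.summable_expReward hr h0 h1 π
  unfold MDP.policyQ
  rw [(hs s a).tsum_eq_zero_add]
  congr 1
  · simp [MDP.expReward]
  · simp_rw [← tsum_mul_left]
    rw [← Summable.tsum_finsetSum fun s' _ => (hs s' (π s')).mul_left _, ← tsum_mul_left]
    refine tsum_congr fun i => ?_
    simp only [MDP.expReward, Finset.mul_sum]
    exact Finset.sum_congr rfl fun s' _ => by ring

/-- A fixed point of the Bellman optimality operator is the vector of optimal Q-values: it bounds
the values of every policy, and equals those of the policy that is greedy for it. In both cases the
largest difference `d` of the two sides satisfies `d ≤ γ * d`. -/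
lemma MDP.optQ_eq_of_bellman [Finite A] [Nonempty A] [Nonempty S]
    (hr : ∀ s a, ∀ᵐ x ∂(D.law s a), |x.1| ≤ Rmax) (h0 : 0 < γ) (h1 : γ < 1) {Q : S → A → ℝ}
    (hQ : ∀ s a, Q s a = D.R s a + γ * ∑ s', D.P s a s' * ⨆ a', Q s' a') :
    D.optQ γ = Q := by
  have hbdd : ∀ s, BddAbove (Set.range (Q s)) := fun s => (Set.finite_range _).bddAbove
  have hle : ∀ π s a, D.policyQ γ π s a ≤ Q s a := by
    intro π
    obtain ⟨⟨s₀, a₀⟩, hmax⟩ := Finite.exists_max fun p : S × A =>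
      D.policyQ γ π p.1 p.2 - Q p.1 p.2
    set d := D.policyQ γ π s₀ a₀ - Q s₀ a₀ with hd
    have key : d ≤ γ * d := by
      have h : ∑ s', D.P s₀ a₀ s' * D.policyQ γ π s' (π s') ≤
          ∑ s', D.P s₀ a₀ s' * ((⨆ a', Q s' a') + d) :=
        Finset.sum_le_sum fun s' _ => mul_le_mul_of_nonneg_left
          (by linarith [le_ciSup (hbdd s') (π s'), hmax (s', π s')]) (D.P_nonneg _ _ _)
      simp only [mul_add, Finset.sum_add_distrib, ← Finset.sum_mul, D.sum_P, one_mul] at h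
      have h2 := mul_le_mul_of_nonneg_left h h0.le
      linarith [D.policyQ_eq hr h0 h1 π s₀ a₀, hQ s₀ a₀]
    have hd0 : d ≤ 0 := by nlinarith
    intro s a
    linarith [hmax (s, a)]
  choose π hπ using fun s => exists_eq_ciSup_of_finite (f := Q s)
  have heq : ∀ s a, D.policyQ γ π s a = Q s a := by
    obtain ⟨⟨s₀, a₀⟩, hmax⟩ := Finite.exists_max fun p : S × A =>
      |D.policyQ γ π p.1 p.2 - Q p.1 p.2|
    set d := |D.policyQ γ π s₀ a₀ - Q s₀ a₀| with hd
    have key : d ≤ γ * d := by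
      have h := D.abs_sum_P_mul_le s₀ a₀ (V := fun s' => D.policyQ γ π s' (π s') - Q s' (π s'))
        fun s' => hmax (s', π s')
      have h2 : D.policyQ γ π s₀ a₀ - Q s₀ a₀ =
          γ * ∑ s', D.P s₀ a₀ s' * (D.policyQ γ π s' (π s') - Q s' (π s')) := by
        rw [D.policyQ_eq hr h0 h1, hQ s₀ a₀]
        simp only [mul_sub, Finset.sum_sub_distrib, hπ]
        ring
      calc d = γ * |∑ s', D.P s₀ a₀ s' * (D.policyQ γ π s' (π s') - Q s' (π s'))| := by
            rw [hd, h2, abs_mul, abs_of_pos h0]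
        _ ≤ γ * d := mul_le_mul_of_nonneg_left h h0.le
    have hd0 : d ≤ 0 := by nlinarith
    intro s a
    exact sub_eq_zero.1 (abs_nonpos_iff.1 ((hmax (s, a)).trans hd0))
  funext s a
  refine le_antisymm (ciSup_le fun π' => hle π' s a) ?_
  rw [← heq s a]
  exact le_ciSup (f := fun π' => D.policyQ γ π' s a) (Set.finite_range _).bddAbove π

/-- The Bellman optimality equation. A solution exists by the contraction principle, and
`MDP.optQ_eq_of_bellman` identifies it. -/
theorem MDP.optQ_eq [Fintype A] [Nonempty A] [Nonempty S]
    (hr : ∀ s a, ∀ᵐ x ∂(D.law s a), |x.1| ≤ Rmax) (h0 : 0 < γ) (h1 : γ < 1) (s : S) (a : A) :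
    D.optQ γ s a = D.R s a + γ * ∑ s', D.P s a s' * ⨆ a', D.optQ γ s' a' := by
  let T : (S → A → ℝ) → S → A → ℝ := fun Q s a =>
    D.R s a + γ * ∑ s', D.P s a s' * ⨆ a', Q s' a'
  have hT : ContractingWith ⟨γ, h0.le⟩ T := by
    refine ⟨h1, LipschitzWith.of_dist_le_mul fun Q Q' => ?_⟩
    rw [dist_eq_norm, dist_eq_norm]
    refine norm_le_of_forall_abs_le (mul_nonneg h0.le (norm_nonneg _)) fun s a => ?_
    have h := D.abs_sum_P_mul_le s a (V := fun s' => (⨆ a', Q s' a') - ⨆ a', Q' s' a')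
      fun s' => abs_iSup_sub_iSup_le fun a' => abs_apply_apply_le_norm (Q - Q') s' a'
    have h2 : (T Q - T Q') s a =
        γ * ∑ s', D.P s a s' * ((⨆ a', Q s' a') - ⨆ a', Q' s' a') := by
      simp only [T, Pi.sub_apply, mul_sub, Finset.sum_sub_distrib]
      ring
    rw [h2, abs_mul, abs_of_pos h0]
    exact mul_le_mul_of_nonneg_left h h0.le
  have hfix := hT.fixedPoint_isFixedPt
  rw [D.optQ_eq_of_bellman hr h0 h1 (Q := hT.fixedPoint T) fun s a =>
    (congrFun (congrFun hfix s) a).symm]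
  exact (congrFun (congrFun hfix s) a).symm

lemma Vmax_eq {γ Rmax : ℝ} (h1 : γ < 1) : Rmax + γ * Vmax γ Rmax = Vmax γ Rmax := by
  have : 1 - γ ≠ 0 := by linarith
  unfold Vmax
  field_simp
  ring

lemma MDP.abs_optQ_le [Fintype A] [Nonempty A] [Nonempty S]
    (hr : ∀ s a, ∀ᵐ x ∂(D.law s a), |x.1| ≤ Rmax) (h0 : 0 < γ) (h1 : γ < 1) (s : S) (a : A) :
    |D.optQ γ s a| ≤ Vmax γ Rmax := by
  obtain ⟨⟨s₀, a₀⟩, hmax⟩ := Finite.exists_max fun p : S × A => |D.optQ γ p.1 p.2|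
  refine (hmax (s, a)).trans ?_
  have h : |D.optQ γ s₀ a₀| ≤ Rmax + γ * |D.optQ γ s₀ a₀| := by
    conv_lhs => rw [D.optQ_eq hr h0 h1]
    refine (abs_add_le _ _).trans (add_le_add (D.abs_R_le (hr _ _)) ?_)
    rw [abs_mul, abs_of_pos h0]
    exact mul_le_mul_of_nonneg_left
      (D.abs_sum_P_mul_le _ _ fun s' => abs_iSup_le fun a' => hmax (s', a')) h0.le
  rw [Vmax, le_div_iff₀ (by linarith)]
  simp only
  linarith

end

/-! ### The pathwise recursion -/

/-- With learning rates `1 / n`, the Q-value is the average of all update targets. -/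
lemma mul_qValues_eq_sum {S A : Type*} (γ : ℝ) (Q₀ : S → A → ℝ) (z : ℕ → S → A → ℝ × S) (t : ℕ)
    (s : S) (a : A) :
    t * qValues γ Q₀ z t s a =
      ∑ i ∈ Finset.range t, ((z i s a).1 + γ * ⨆ a', qValues γ Q₀ z i (z i s a).2 a') := by
  induction t with
  | zero => simp
  | succ t ih =>
    rw [Finset.sum_range_succ, ← ih, qValues]
    have : (t : ℝ) + 1 ≠ 0 := by positivity
    push_cast
    field_simp
    ring

lemma abs_qValues_le {S A : Type*} [Fintype S] [Fintype A] [Nonempty A] {γ Rmax : ℝ}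
    (h0 : 0 < γ) (h1 : γ < 1) (Q₀ : S → A → ℝ) {z : ℕ → S → A → ℝ × S}
    (hz : ∀ i s a, |(z i s a).1| ≤ Rmax) (t : ℕ) :
    ∀ s a, |qValues γ Q₀ z t s a| ≤ max ‖Q₀‖ (Vmax γ Rmax) := by
  set m := max ‖Q₀‖ (Vmax γ Rmax)
  have hm : Rmax + γ * m ≤ m := by
    have h2 : Vmax γ Rmax ≤ m := le_max_right _ _
    rw [Vmax, div_le_iff₀ (by linarith)] at h2
    linarith
  induction t with
  | zero => exact fun s a => (abs_apply_apply_le_norm Q₀ s a).trans (le_max_left _ _)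
  | succ t ih =>
    intro s a
    rw [qValues]
    set w : ℝ := 1 / ((t : ℝ) + 1)
    have hw0 : 0 ≤ w := by positivity
    have hw1 : w ≤ 1 := by
      rw [div_le_one (by positivity)]
      linarith [(Nat.cast_nonneg t : (0 : ℝ) ≤ t)]
    have htarget : |(z t s a).1 + γ * ⨆ a', qValues γ Q₀ z t (z t s a).2 a'| ≤ m := by
      refine (abs_add_le _ _).trans ((add_le_add (hz t s a) ?_).trans hm)
      rw [abs_mul, abs_of_pos h0]
      exact mul_le_mul_of_nonneg_left (abs_iSup_le fun a' => ih _ a') h0.le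
    calc _ ≤ (1 - w) * m + w * m := by
          refine (abs_add_le _ _).trans (add_le_add ?_ ?_)
          · rw [abs_mul, abs_of_nonneg (by linarith)]
            exact mul_le_mul_of_nonneg_left (ih s a) (by linarith)
          · rw [abs_mul, abs_of_nonneg hw0]
            exact mul_le_mul_of_nonneg_left htarget hw0
      _ = m := by ring

/-- The error after `t` steps is at most the averaged noise (the targets with `Qs` in place of the
current Q-values) plus `γ` times the average of the earlier errors. -/
lemma mul_norm_qValues_sub_le {S A : Type*} [Fintype S] [Fintype A] [Nonempty A] {γ η : ℝ}
    (h0 : 0 < γ) (hη : 0 ≤ η) (Q₀ Qs : S → A → ℝ) (z : ℕ → S → A → ℝ × S) (t : ℕ)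
    (hnoise : ∀ s a, |∑ i ∈ Finset.range t,
      ((z i s a).1 + γ * (⨆ a', Qs (z i s a).2 a') - Qs s a)| ≤ t * η) :
    t * ‖qValues γ Q₀ z t - Qs‖ ≤
      t * η + γ * ∑ i ∈ Finset.range t, ‖qValues γ Q₀ z i - Qs‖ := by
  have hsum : 0 ≤ ∑ i ∈ Finset.range t, ‖qValues γ Q₀ z i - Qs‖ :=
    Finset.sum_nonneg fun _ _ => norm_nonneg _
  have ht : (0 : ℝ) ≤ t := Nat.cast_nonneg t
  rw [← Real.norm_of_nonneg ht, ← norm_smul, Real.norm_of_nonneg ht]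
  refine norm_le_of_forall_abs_le (by positivity) fun s a => ?_
  have hsplit : ((t : ℝ) • (qValues γ Q₀ z t - Qs)) s a =
      ∑ i ∈ Finset.range t, ((z i s a).1 + γ * (⨆ a', Qs (z i s a).2 a') - Qs s a) +
      γ * ∑ i ∈ Finset.range t,
        ((⨆ a', qValues γ Q₀ z i (z i s a).2 a') - ⨆ a', Qs (z i s a).2 a') := by
    simp only [Pi.smul_apply, Pi.sub_apply, smul_eq_mul, mul_sub, mul_qValues_eq_sum,
      Finset.sum_add_distrib, Finset.sum_sub_distrib, Finset.mul_sum, Finset.sum_const,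
      Finset.card_range, nsmul_eq_mul]
    ring
  rw [hsplit]
  refine (abs_add_le _ _).trans (add_le_add (hnoise s a) ?_)
  rw [abs_mul, abs_of_pos h0]
  refine mul_le_mul_of_nonneg_left ((Finset.abs_sum_le_sum_abs _ _).trans ?_) h0.le
  exact Finset.sum_le_sum fun i _ => abs_iSup_sub_iSup_le fun a' =>
    abs_apply_apply_le_norm (qValues γ Q₀ z i - Qs) _ a'

/-- One step of the decay `((t₀ + 1) / (t + 1)) ^ (1 - γ)`, by Bernoulli's inequality. -/
lemma add_mul_rpow_le {γ τ t : ℝ} (h0 : 0 < γ) (h1 : γ < 1) (hτ : 0 < τ) (ht : 0 ≤ t) :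
    (t + γ) * (τ / (t + 1)) ^ (1 - γ) ≤ (t + 1) * (τ / (t + 1 + 1)) ^ (1 - γ) := by
  have hb : (1 + 1 / (t + 1)) ^ (1 - γ) ≤ 1 + (1 - γ) * (1 / (t + 1)) :=
    rpow_one_add_le_one_add_mul_self (by have : 0 ≤ 1 / (t + 1) := by positivity
                                         linarith) (by linarith) (by linarith)
  have hsplit : τ / (t + 1) = τ / (t + 1 + 1) * (1 + 1 / (t + 1)) := by field_simp
  have hρ : 0 ≤ (τ / (t + 1 + 1)) ^ (1 - γ) := by positivity
  rw [hsplit, Real.mul_rpow (by positivity) (by positivity)]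
  have h2 : (t + γ) * (1 + (1 - γ) * (1 / (t + 1))) ≤ t + 1 := by
    have : (t + γ) * (1 + (1 - γ) * (1 / (t + 1))) = t + 1 - (1 - γ) ^ 2 / (t + 1) := by
      field_simp
      ring
    rw [this]
    have : 0 ≤ (1 - γ) ^ 2 / (t + 1) := by positivity
    linarith
  calc _ = (τ / (t + 1 + 1)) ^ (1 - γ) * ((t + γ) * (1 + 1 / (t + 1)) ^ (1 - γ)) := by ring
    _ ≤ (τ / (t + 1 + 1)) ^ (1 - γ) * (t + 1) := by
      refine mul_le_mul_of_nonneg_left (le_trans ?_ h2) hρ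
      exact mul_le_mul_of_nonneg_left hb (by linarith)
    _ = _ := by ring

/-- A bounded sequence that is eventually at most `η` plus `γ` times the average of its earlier
terms approaches `η / (1 - γ)` at the polynomial rate `t ^ (-(1 - γ))`. -/
lemma le_of_averaged_contraction {γ η d : ℝ} (h0 : 0 < γ) (h1 : γ < 1) (hd : 0 ≤ d) {u : ℕ → ℝ}
    (hud : ∀ t, u t ≤ d) {t₀ : ℕ} (ht₀ : 0 < t₀) (hη : 0 ≤ η)
    (hu : ∀ t, t₀ ≤ t → t * u t ≤ t * η + γ * ∑ i ∈ Finset.range t, u i) (t : ℕ) (ht : t₀ ≤ t) :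
    u t ≤ η / (1 - γ) + d * (((t₀ : ℝ) + 1) / (t + 1)) ^ (1 - γ) := by
  set e : ℝ := η / (1 - γ) with he
  have heq : η = (1 - γ) * e := by
    rw [he, mul_div_cancel₀]
    linarith
  have he0 : 0 ≤ e := div_nonneg hη (by linarith)
  have hsum : ∀ t, t₀ ≤ t → ∑ i ∈ Finset.range t, u i ≤
      t * (e + d * (((t₀ : ℝ) + 1) / (t + 1)) ^ (1 - γ)) := by
    intro t ht
    induction t, ht using Nat.le_induction with
    | base =>
      rw [div_self (by positivity), Real.one_rpow]
      calc ∑ i ∈ Finset.range t₀, u i ≤ t₀ * d := by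
            simpa using Finset.sum_le_sum fun i (_ : i ∈ Finset.range t₀) => hud i
        _ ≤ _ := by gcongr; linarith
    | succ t ht ih =>
      have htpos : (0 : ℝ) < t := by exact_mod_cast ht₀.trans_le ht
      have hstep := add_mul_rpow_le h0 h1 (τ := (t₀ : ℝ) + 1) (by positivity) htpos.le
      have hut := hu t ht
      set ρ := (((t₀ : ℝ) + 1) / (t + 1)) ^ (1 - γ)
      rw [Finset.sum_range_succ]
      push_cast
      set ρ' := (((t₀ : ℝ) + 1) / (t + 1 + 1)) ^ (1 - γ)
      have hut' : u t ≤ η + γ * (e + d * ρ) := by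
        refine le_of_mul_le_mul_left ?_ htpos
        nlinarith
      have := mul_le_mul_of_nonneg_left hstep hd
      nlinarith
  have htpos : (0 : ℝ) < t := by exact_mod_cast ht₀.trans_le ht
  have hρ : 0 ≤ (((t₀ : ℝ) + 1) / (t + 1)) ^ (1 - γ) := by positivity
  refine le_of_mul_le_mul_left ?_ htpos
  have h2 := mul_le_mul_of_nonneg_left (hsum t ht) h0.le
  have h3 := hu t ht
  have h4 : 0 ≤ t * ((1 - γ) * (d * (((t₀ : ℝ) + 1) / (t + 1)) ^ (1 - γ))) := by
    have : 0 ≤ 1 - γ := by linarith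
    positivity
  rw [heq] at h3
  nlinarith

/-! ### The size of the memory -/

/-- The memory holds at least a fraction `1 / (M + 1)` of the past, since every round starts with an
online iteration and contains only `M` replays. -/
lemma le_mul_card_memory {K : ℕ} (M : ℕ) (hK : 0 < K) (k : ℕ) :
    k ≤ (M + 1) * (memory K M k).card := by
  -- The credit of `M` gained at the first online iteration of a round is spent during its replays.
  suffices h : k + (if k % (K + M) = 0 then 0 else M) ≤
      (M + 1) * (memory K M k).card + (k % (K + M) - K) by
    have := Nat.mod_lt k (show 0 < K + M by omega)
    split_ifs at h <;> omega
  induction k with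
  | zero => simp
  | succ k ih =>
    have hlt := Nat.mod_lt k (show 0 < K + M by omega)
    have hmod : (k + 1) % (K + M) = if k % (K + M) + 1 = K + M then 0 else k % (K + M) + 1 := by
      rw [← Nat.mod_add_mod]
      split_ifs with h
      · rw [h, Nat.mod_self]
      · exact Nat.mod_eq_of_lt (by omega)
    have hcard : (memory K M (k + 1)).card =
        (memory K M k).card + if k % (K + M) < K then 1 else 0 := by
      unfold memory
      rw [Finset.range_add_one, Finset.filter_insert]
      split_ifs with h
      · rw [Finset.card_insert_of_notMem (by simp)]
      · rfl
    rw [hcard, hmod, Nat.mul_add]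
    generalize (M + 1) * (memory K M k).card = m at *
    generalize k % (K + M) = r at *
    split_ifs at * <;> omega

/-! ### Independence and concentration -/

section Concentration

variable {Ω : Type*} [MeasurableSpace Ω] {μ : Measure Ω} [IsProbabilityMeasure μ]

/-- If the pairs `(Y k, J k)` are independent, and so are the two entries of each pair, then the
whole sequence `Y` is independent of the whole sequence `J`. -/
lemma indepFun_pi_of_iIndepFun_pair {α β : Type*} [MeasurableSpace α] [MeasurableSpace β]
    [Inhabited α] [Inhabited β] {Y : ℕ → Ω → α} {J : ℕ → Ω → β}
    (hY : ∀ k, Measurable (Y k)) (hJ : ∀ k, Measurable (J k))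
    (hpair : iIndepFun (fun k ω => (Y k ω, J k ω)) μ) (hYJ : ∀ k, IndepFun (Y k) (J k) μ) :
    IndepFun (fun ω k => Y k ω) (fun ω k => J k ω) μ := by
  -- Padding with default values gives all the variables the same target space.
  let Z : ℕ → Bool → Ω → α × β := fun k b ω => if b then (Y k ω, default) else (default, J k ω)
  have hZ : ∀ k b, Measurable (Z k b) := by
    rintro k (_ | _)
    · exact measurable_const.prodMk (hJ k)
    · exact (hY k).prodMk measurable_const
  have h1 : iIndepFun (fun k ω => (Z k · ω)) μ := by
    refine hpair.comp (fun _ p (b : Bool) => if b then (p.1, default) else (default, p.2)) fun _ => ?_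
    refine measurable_pi_iff.2 ?_
    rintro (_ | _)
    · exact measurable_const.prodMk measurable_snd
    · exact measurable_fst.prodMk measurable_const
  have h2 : ∀ k, iIndepFun (Z k) μ := by
    intro k
    have (b : Bool) : IsProbabilityMeasure (μ.map (Z k b)) :=
      Measure.isProbabilityMeasure_map (hZ k b).aemeasurable
    rw [iIndepFun_iff_map_fun_eq_pi_map fun b => (hZ k b).aemeasurable]
    refine (Measure.pi_eq fun s hs => ?_).symm
    rw [Measure.map_apply (measurable_pi_iff.2 (hZ k)) (MeasurableSet.univ_pi hs),
      Fintype.prod_bool, Measure.map_apply (hZ k true) (hs true),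
      Measure.map_apply (hZ k false) (hs false)]
    have hset : (fun ω b => Z k b ω) ⁻¹' Set.univ.pi s =
        Y k ⁻¹' ((fun y => (y, default)) ⁻¹' s true) ∩
          J k ⁻¹' ((fun j => (default, j)) ⁻¹' s false) := by
      ext ω
      simp [Z, and_comm]
    have hα : Measurable fun y : α => (y, (default : β)) := by fun_prop
    have hβ : Measurable fun j : β => ((default : α), j) := by fun_prop
    rw [hset, (hYJ k).measure_inter_preimage_eq_mul _ _ (hα (hs true)) (hβ (hs false))]
    rfl
  have h3 := (iIndepFun_uncurry' hZ h1 h2).iIndep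
  have h4 := indep_iSup_of_disjoint (fun p => (hZ p.1 p.2).comap_le) h3
    (S := {p : ℕ × Bool | p.2 = true}) (T := {p : ℕ × Bool | p.2 = false})
    (Set.disjoint_left.2 fun p hp hp' => by simp_all)
  rw [IndepFun_iff_Indep]
  refine indep_of_indep_of_le h4 ?_ ?_
  · simp only [MeasurableSpace.pi, MeasurableSpace.comap_iSup, MeasurableSpace.comap_comp]
    refine iSup_le fun k => le_iSup₂_of_le (k, true) rfl ?_
    change MeasurableSpace.comap (Prod.fst ∘ Z k true) _ ≤ _
    rw [← MeasurableSpace.comap_comp]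
    exact MeasurableSpace.comap_mono measurable_fst.comap_le
  · simp only [MeasurableSpace.pi, MeasurableSpace.comap_iSup, MeasurableSpace.comap_comp]
    refine iSup_le fun k => le_iSup₂_of_le (k, false) rfl ?_
    change MeasurableSpace.comap (Prod.snd ∘ Z k false) _ ≤ _
    rw [← MeasurableSpace.comap_comp]
    exact MeasurableSpace.comap_mono measurable_snd.comap_le

/-- To bound the probability of an event that involves two independent variables it is enough to
bound it with the first one frozen at almost every value. -/
lemma measure_pair_mem_le_of_forall_section {α β : Type*} [MeasurableSpace α] [MeasurableSpace β]
    {U : Ω → α} {W : Ω → β} (hU : Measurable U) (hW : Measurable W) (h : IndepFun U W μ)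
    {E : Set (α × β)} (hE : MeasurableSet E) {b : ENNReal}
    (hb : ∀ᵐ ω ∂μ, μ {ω' | (U ω, W ω') ∈ E} ≤ b) : μ {ω | (U ω, W ω) ∈ E} ≤ b := by
  have := Measure.isProbabilityMeasure_map (μ := μ) hW.aemeasurable
  have h1 : μ {ω | (U ω, W ω) ∈ E} = ((μ.map U).prod (μ.map W)) E := by
    rw [← (indepFun_iff_map_prod_eq_prod_map_map hU.aemeasurable hW.aemeasurable).1 h,
      Measure.map_apply (hU.prodMk hW) hE]
    rfl
  rw [h1, Measure.prod_apply hE, lintegral_map (measurable_measure_prodMk_left hE) hU]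
  calc _ ≤ ∫⁻ _, b ∂μ := by
        refine lintegral_mono_ae (hb.mono fun ω hω => ?_)
        rwa [Measure.map_apply hW (measurable_prodMk_left hE)]
    _ = b := by simp

/-- Two-sided Hoeffding inequality for at most `n` centred variables of range `2 * V`. -/
lemma measureReal_le_abs_sum_le {ι : Type*} {Z : ι → Ω → ℝ} (hind : iIndepFun Z μ) {s : Finset ι}
    {V : ℝ} (hm : ∀ i ∈ s, AEMeasurable (Z i) μ)
    (hbd : ∀ i ∈ s, ∃ a, ∀ᵐ ω ∂μ, Z i ω ∈ Set.Icc a (a + 2 * V))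
    (h0 : ∀ i ∈ s, μ[Z i] = 0) {n x : ℝ} (hn : s.card ≤ n) (hV : 0 < V) (hx : 0 < x) :
    μ.real {ω | x ≤ |∑ i ∈ s, Z i ω|} ≤ 2 * Real.exp (-x ^ 2 / (2 * n * V ^ 2)) := by
  rcases s.eq_empty_or_nonempty with rfl | hs
  · have : {ω : Ω | x ≤ |∑ i ∈ (∅ : Finset ι), Z i ω|} = ∅ := by
      ext ω
      simpa using hx
    rw [this, measureReal_empty]
    positivity
  lift V to NNReal using hV.le
  have hsub : ∀ i ∈ s, HasSubgaussianMGF (Z i) (V ^ 2) μ := by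
    intro i hi
    obtain ⟨a, ha⟩ := hbd i hi
    have h := hasSubgaussianMGF_of_mem_Icc_of_integral_eq_zero (hm i hi) ha (h0 i hi)
    have hc : (‖a + 2 * (V : ℝ) - a‖₊ / 2) ^ 2 = V ^ 2 := by
      ext
      simp
    rwa [hc] at h
  have hcard : (0 : ℝ) < s.card := by exact_mod_cast hs.card_pos
  have hsum : ((∑ _i ∈ s, V ^ 2 : NNReal) : ℝ) = s.card * V ^ 2 := by
    simp
  have hexp : Real.exp (-x ^ 2 / (2 * (s.card * V ^ 2))) ≤
      Real.exp (-x ^ 2 / (2 * n * V ^ 2)) := by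
    rw [Real.exp_le_exp, neg_div, neg_div, neg_le_neg_iff, mul_assoc]
    gcongr
  rw [← hsum] at hexp
  have h1 := HasSubgaussianMGF.measure_sum_ge_le_of_iIndepFun hind hsub hx.le
  have h2 := HasSubgaussianMGF.measure_sum_ge_le_of_iIndepFun
    (hind.comp (fun _ y => -y) fun _ => measurable_neg) (fun i hi => (hsub i hi).neg) hx.le
  have hset : {ω | x ≤ |∑ i ∈ s, Z i ω|} ⊆
      {ω | x ≤ ∑ i ∈ s, Z i ω} ∪ {ω | x ≤ ∑ i ∈ s, ((fun y => -y) ∘ Z i) ω} := by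
    intro ω hω
    simpa [Finset.sum_neg_distrib, le_abs] using hω
  calc _ ≤ _ := (measureReal_mono hset).trans (measureReal_union_le _ _)
    _ ≤ _ := add_le_add (h1.trans hexp) (h2.trans hexp)
    _ = _ := by ring

lemma integral_comp_of_uniform {J : Ω → ℕ} (hJ : Measurable J) {s : Finset ℕ} (hs : s.Nonempty)
    (hlaw : ∀ j ∈ s, μ.real {ω | J ω = j} = 1 / (s.card : ℝ)) (y : ℕ → ℝ) :
    ∫ ω, y (J ω) ∂μ = (∑ j ∈ s, y j) / s.card := by
  have hcard : (0 : ℝ) < s.card := by exact_mod_cast hs.card_pos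
  have hmeas : ∀ j, MeasurableSet {ω | J ω = j} := fun j => hJ (measurableSet_singleton j)
  have hmem : ∀ᵐ ω ∂μ, J ω ∈ s := by
    have h1 : μ.real (J ⁻¹' (s : Set ℕ)) = 1 := by
      rw [← sum_measureReal_preimage_singleton s fun j _ => hJ (measurableSet_singleton j)]
      calc _ = ∑ j ∈ s, 1 / (s.card : ℝ) := Finset.sum_congr rfl hlaw
        _ = 1 := by
          rw [Finset.sum_const, nsmul_eq_mul]
          field_simp
    have h2 : μ (J ⁻¹' (s : Set ℕ)) = 1 := by
      rwa [measureReal_def, ENNReal.toReal_eq_one_iff] at h1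
    exact (mem_ae_iff_prob_eq_one (hJ s.measurableSet)).2 h2
  have hae : (fun ω => y (J ω)) =ᵐ[μ]
      fun ω => ∑ j ∈ s, Set.indicator {ω | J ω = j} (fun _ => y j) ω := by
    filter_upwards [hmem] with ω hω
    simp [Set.indicator_apply, hω]
  rw [integral_congr_ae hae, integral_finsetSum _ fun j _ =>
    (integrable_const _).indicator (hmeas j), Finset.sum_div]
  refine Finset.sum_congr rfl fun j hj => ?_
  rw [integral_indicator_const _ (hmeas j), hlaw j hj, smul_eq_mul]
  ring

/-- The mean of `y` over the memory before iteration `k`. -/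
noncomputable def memoryMean (K M : ℕ) (y : ℕ → ℝ) (k : ℕ) : ℝ :=
  (∑ j ∈ memory K M k, y j) / (memory K M k).card

/-- The replay iterations before iteration `k`. -/
def replays (K M k : ℕ) : Finset ℕ := (Finset.range k).filter fun i => ¬ IsOnline K M i

lemma card_replays_le (K M k : ℕ) : ((replays K M k).card : ℝ) ≤ k := by
  exact_mod_cast (Finset.card_filter_le _ _).trans (Finset.card_range k).le

lemma card_memory_le (K M k : ℕ) : ((memory K M k).card : ℝ) ≤ k := by
  exact_mod_cast (Finset.card_filter_le _ _).trans (Finset.card_range k).le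

lemma card_memory_pos {K k : ℕ} (M : ℕ) (hK : 0 < K) (hk : 0 < k) : 0 < (memory K M k).card := by
  by_contra h
  have := le_mul_card_memory M hK k
  simp_all

variable {Y : ℕ → Ω → ℝ} {J : ℕ → Ω → ℕ} {K M : ℕ} {a V θ : ℝ}

lemma measureReal_memory_sum_le (hK : 0 < K) (hY : ∀ k, Measurable (Y k)) (hind : iIndepFun Y μ)
    (hV : 0 < V) (hbd : ∀ k, ∀ᵐ ω ∂μ, Y k ω ∈ Set.Icc a (a + 2 * V)) (h0 : ∀ k, μ[Y k] = 0)
    (hθ : 0 < θ) {k : ℕ} (hk : 0 < k) :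
    μ.real {ω | θ * (memory K M k).card ≤ |∑ j ∈ memory K M k, Y j ω|} ≤
      2 * Real.exp (-(θ ^ 2 / (2 * (M + 1) * V ^ 2))) ^ k := by
  have hm : (0 : ℝ) < (memory K M k).card := by exact_mod_cast card_memory_pos M hK hk
  refine (measureReal_le_abs_sum_le hind (fun j _ => (hY j).aemeasurable)
    (fun j _ => ⟨a, hbd j⟩) (fun j _ => h0 j) le_rfl hV (mul_pos hθ hm)).trans ?_
  rw [← Real.exp_nat_mul]
  gcongr
  have hle : (k : ℝ) ≤ (M + 1) * (memory K M k).card := by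
    exact_mod_cast le_mul_card_memory M hK k
  rw [neg_div, mul_neg, neg_le_neg_iff, ← mul_div_assoc,
    div_le_div_iff₀ (by positivity) (by positivity)]
  have := mul_le_mul_of_nonneg_right hle
    (show 0 ≤ θ ^ 2 * (2 * (memory K M k).card * V ^ 2) by positivity)
  linarith

lemma measureReal_replay_sum_frozen_le (hK : 0 < K) (hJ : ∀ k, Measurable (J k))
    (hlaw : ∀ k, ¬ IsOnline K M k → ∀ j ∈ memory K M k,
      μ.real {ω | J k ω = j} = 1 / ((memory K M k).card : ℝ))
    (hind : iIndepFun J μ) (hV : 0 < V) {y : ℕ → ℝ} (hy : ∀ j, y j ∈ Set.Icc a (a + 2 * V))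
    (hθ : 0 < θ) {k : ℕ} (hk : 0 < k) :
    μ.real {ω | θ * k ≤ |∑ i ∈ replays K M k, (y (J i ω) - memoryMean K M y i)|} ≤
      2 * Real.exp (-(θ ^ 2 / (2 * (M + 1) * V ^ 2))) ^ k := by
  have hk' : (0 : ℝ) < k := by exact_mod_cast hk
  have hyJ : ∀ i, Measurable fun ω => y (J i ω) := fun i => Measurable.of_discrete.comp (hJ i)
  refine (measureReal_le_abs_sum_le (V := V) (n := k)
    (hind.comp (fun i j => y j - memoryMean K M y i) fun _ => Measurable.of_discrete)
    (fun i _ => ((hyJ i).sub_const _).aemeasurable)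
    (fun i _ => ⟨a - memoryMean K M y i, ae_of_all _ fun ω => ?_⟩) (fun i hi => ?_)
    (card_replays_le K M k) hV (mul_pos hθ hk')).trans ?_
  · have := hy (J i ω)
    simp only [Function.comp_apply, Set.mem_Icc] at *
    constructor <;> linarith
  · have hi' : ¬ IsOnline K M i := (Finset.mem_filter.1 hi).2
    have hi0 : 0 < i := by
      rcases Nat.eq_zero_or_pos i with rfl | h
      · exact absurd (by simpa [IsOnline] using hK) hi'
      · exact h
    have hint : Integrable (fun ω => y (J i ω)) μ :=
      Integrable.of_mem_Icc a (a + 2 * V) (hyJ i).aemeasurable (ae_of_all _ fun ω => hy _)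
    change ∫ ω, (y (J i ω) - memoryMean K M y i) ∂μ = 0
    rw [integral_sub hint (integrable_const _), integral_comp_of_uniform (hJ i)
      (Finset.card_pos.1 (card_memory_pos M hK hi0)) (hlaw i hi')]
    simp [memoryMean]
  · rw [← Real.exp_nat_mul]
    gcongr
    rw [neg_div, mul_neg, neg_le_neg_iff, ← mul_div_assoc,
      div_le_div_iff₀ (by positivity) (by positivity)]
    have h1 : 0 ≤ (k : ℝ) ^ 2 * θ ^ 2 * 2 * V ^ 2 * M := by positivity
    nlinarith

/-- Replayed samples deviate little from the means of the memories they are drawn from: with the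
stored samples frozen, the draws are independent and uniform. -/
lemma measure_replay_sum_le (hK : 0 < K) (hY : ∀ k, Measurable (Y k)) (hJ : ∀ k, Measurable (J k))
    (hlaw : ∀ k, ¬ IsOnline K M k → ∀ j ∈ memory K M k,
      μ.real {ω | J k ω = j} = 1 / ((memory K M k).card : ℝ))
    (hpair : iIndepFun (fun k ω => (Y k ω, J k ω)) μ) (hYJ : ∀ k, IndepFun (Y k) (J k) μ)
    (hV : 0 < V) (hbd : ∀ k, ∀ᵐ ω ∂μ, Y k ω ∈ Set.Icc a (a + 2 * V)) (hθ : 0 < θ) {k : ℕ}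
    (hk : 0 < k) :
    μ {ω | θ * k ≤ |∑ i ∈ replays K M k, (Y (J i ω) ω - memoryMean K M (fun j => Y j ω) i)|} ≤
      ENNReal.ofReal (2 * Real.exp (-(θ ^ 2 / (2 * (M + 1) * V ^ 2))) ^ k) := by
  have heval : Measurable fun p : (ℕ → ℝ) × ℕ => p.1 p.2 :=
    measurable_from_prod_countable_left fun j => measurable_pi_apply j
  have hmean : ∀ i, Measurable fun y : ℕ → ℝ => memoryMean K M y i := fun i => by
    unfold memoryMean
    fun_prop
  have hE : MeasurableSet {p : (ℕ → ℝ) × (ℕ → ℕ) |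
      θ * k ≤ |∑ i ∈ replays K M k, (p.1 (p.2 i) - memoryMean K M p.1 i)|} := by
    refine measurableSet_le measurable_const (Measurable.abs (Finset.measurable_fun_sum _ ?_))
    intro i _
    refine Measurable.sub ?_ ((hmean i).comp measurable_fst)
    exact heval.comp (measurable_fst.prodMk ((measurable_pi_apply i).comp measurable_snd))
  refine measure_pair_mem_le_of_forall_section (measurable_pi_iff.2 hY) (measurable_pi_iff.2 hJ)
    (indepFun_pi_of_iIndepFun_pair hY hJ hpair hYJ) hE ?_
  filter_upwards [ae_all_iff.2 hbd] with ω hω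
  rw [← ofReal_measureReal]
  exact ENNReal.ofReal_le_ofReal (measureReal_replay_sum_frozen_le hK hJ hlaw
    (hpair.comp (fun _ p => p.2) fun _ => measurable_snd) hV hω hθ hk)

/-- From iteration `k₀` on, all the memory means and all the replay deviations are small, up to a
probability given by a geometric series. -/
theorem measure_exists_deviation_le (hK : 0 < K) (hY : ∀ k, Measurable (Y k))
    (hJ : ∀ k, Measurable (J k))
    (hlaw : ∀ k, ¬ IsOnline K M k → ∀ j ∈ memory K M k,
      μ.real {ω | J k ω = j} = 1 / ((memory K M k).card : ℝ))
    (hpair : iIndepFun (fun k ω => (Y k ω, J k ω)) μ) (hYJ : ∀ k, IndepFun (Y k) (J k) μ)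
    (hV : 0 < V) (hbd : ∀ k, ∀ᵐ ω ∂μ, Y k ω ∈ Set.Icc a (a + 2 * V)) (h0 : ∀ k, μ[Y k] = 0)
    (hθ : 0 < θ) {k₀ : ℕ} (hk₀ : 0 < k₀) {r : ℝ}
    (hr : r = Real.exp (-(θ ^ 2 / (2 * (M + 1) * V ^ 2)))) :
    μ {ω | ∃ k, k₀ ≤ k ∧ (θ * (memory K M k).card ≤ |∑ j ∈ memory K M k, Y j ω| ∨
      θ * k ≤ |∑ i ∈ replays K M k, (Y (J i ω) ω - memoryMean K M (fun j => Y j ω) i)|)} ≤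
      ENNReal.ofReal (4 * r ^ k₀ / (1 - r)) := by
  have hr0 : 0 ≤ r := hr ▸ (Real.exp_pos _).le
  have hr1 : r < 1 := by
    rw [hr, Real.exp_lt_one_iff, neg_lt_zero]
    positivity
  have hone : ∀ k, 0 < k → μ ({ω | θ * (memory K M k).card ≤ |∑ j ∈ memory K M k, Y j ω|} ∪
      {ω | θ * k ≤ |∑ i ∈ replays K M k, (Y (J i ω) ω - memoryMean K M (fun j => Y j ω) i)|}) ≤
      ENNReal.ofReal (4 * r ^ k) := by
    intro k hk
    have h1 : μ {ω | θ * (memory K M k).card ≤ |∑ j ∈ memory K M k, Y j ω|} ≤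
        ENNReal.ofReal (2 * r ^ k) := by
      rw [← ofReal_measureReal, hr]
      exact ENNReal.ofReal_le_ofReal (measureReal_memory_sum_le hK hY
        (hpair.comp (fun _ p => p.1) fun _ => measurable_fst) hV hbd h0 hθ hk)
    have h2 := measure_replay_sum_le hK hY hJ hlaw hpair hYJ hV hbd hθ hk
    rw [← hr] at h2
    refine (measure_union_le _ _).trans ((add_le_add h1 h2).trans ?_)
    rw [← ENNReal.ofReal_add (by positivity) (by positivity)]
    exact ENNReal.ofReal_le_ofReal (by linarith)
  have hsub : {ω | ∃ k, k₀ ≤ k ∧ (θ * (memory K M k).card ≤ |∑ j ∈ memory K M k, Y j ω| ∨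
      θ * k ≤ |∑ i ∈ replays K M k, (Y (J i ω) ω - memoryMean K M (fun j => Y j ω) i)|)} ⊆
      ⋃ i : ℕ, ({ω | θ * (memory K M (i + k₀)).card ≤ |∑ j ∈ memory K M (i + k₀), Y j ω|} ∪
      {ω | θ * ((i + k₀ : ℕ) : ℝ) ≤ |∑ i ∈ replays K M (i + k₀),
        (Y (J i ω) ω - memoryMean K M (fun j => Y j ω) i)|}) := by
    rintro ω ⟨k, hk, h⟩
    obtain ⟨i, rfl⟩ := Nat.exists_eq_add_of_le' hk
    exact Set.mem_iUnion.2 ⟨i, h⟩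
  have hsummable : Summable fun i : ℕ => 4 * r ^ (i + k₀) := by
    simp_rw [pow_add]
    exact ((summable_geometric_of_lt_one hr0 hr1).mul_right _).mul_left _
  calc _ ≤ _ := (measure_mono hsub).trans (measure_iUnion_le _)
    _ ≤ ∑' i : ℕ, ENNReal.ofReal (4 * r ^ (i + k₀)) :=
      ENNReal.tsum_le_tsum fun i => hone _ (by omega)
    _ = ENNReal.ofReal (4 * r ^ k₀ / (1 - r)) := by
      rw [← ENNReal.ofReal_tsum_of_nonneg (fun i => by positivity) hsummable]
      congr 1
      simp_rw [pow_add]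
      rw [tsum_mul_left, tsum_mul_right, tsum_geometric_of_lt_one hr0 hr1]
      field_simp

end Concentration

/-- The noise of the experience splits into the fresh samples, the deviations of the replayed
samples from the means of their memories, and these means. The early means are only bounded, which
is harmless once `t` is large compared with `k₀`. -/
lemma abs_sum_experience_le {K M : ℕ} {y : ℕ → ℝ} {j : ℕ → ℕ} {θ b : ℝ} (hθ : 0 ≤ θ)
    (hb : 0 ≤ b) (hy : ∀ i, |y i| ≤ b) {k₀ t : ℕ} (hk₀ : k₀ ≤ t) (ht : b * k₀ ≤ θ * t)
    (hmem : ∀ k, k₀ ≤ k → |∑ i ∈ memory K M k, y i| ≤ θ * (memory K M k).card)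
    (hrep : |∑ i ∈ replays K M t, (y (j i) - memoryMean K M y i)| ≤ θ * t) :
    |∑ i ∈ Finset.range t, y (if IsOnline K M i then i else j i)| ≤ t * (4 * θ) := by
  have hsplit : ∑ i ∈ Finset.range t, y (if IsOnline K M i then i else j i) =
      ∑ i ∈ memory K M t, y i + ∑ i ∈ replays K M t, (y (j i) - memoryMean K M y i) +
        ∑ i ∈ replays K M t, memoryMean K M y i := by
    rw [add_assoc, ← Finset.sum_add_distrib, memory, replays,
      ← Finset.sum_filter_add_sum_filter_not (Finset.range t) (IsOnline K M)]
    congr 1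
    · exact Finset.sum_congr rfl fun i hi => by rw [if_pos (Finset.mem_filter.1 hi).2]
    · exact Finset.sum_congr rfl fun i hi => by rw [if_neg (Finset.mem_filter.1 hi).2]; ring
  have hearly : ∀ k, |memoryMean K M y k| ≤ b := by
    intro k
    rw [memoryMean, abs_div, Nat.abs_cast]
    refine div_le_of_le_mul₀ (Nat.cast_nonneg _) hb ((Finset.abs_sum_le_sum_abs _ _).trans ?_)
    simpa [mul_comm] using Finset.sum_le_sum fun i (_ : i ∈ memory K M k) => hy i
  have hlate : ∀ k, k₀ ≤ k → |memoryMean K M y k| ≤ θ := by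
    intro k hk
    rw [memoryMean, abs_div, Nat.abs_cast]
    exact div_le_of_le_mul₀ (Nat.cast_nonneg _) hθ (hmem k hk)
  have hmeans : |∑ i ∈ replays K M t, memoryMean K M y i| ≤ b * k₀ + θ * t := by
    refine (Finset.abs_sum_le_sum_abs _ _).trans ?_
    calc ∑ i ∈ replays K M t, |memoryMean K M y i|
        ≤ ∑ i ∈ Finset.range t, |memoryMean K M y i| :=
          Finset.sum_le_sum_of_subset_of_nonneg (Finset.filter_subset _ _)
            fun _ _ _ => abs_nonneg _
      _ ≤ ∑ i ∈ Finset.range t, ((if i < k₀ then b else 0) + θ) := by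
          refine Finset.sum_le_sum fun i _ => ?_
          split_ifs with h
          · linarith [hearly i]
          · linarith [hlate i (not_lt.1 h)]
      _ ≤ b * k₀ + θ * t := by
          rw [Finset.sum_add_distrib, ← Finset.sum_filter]
          have : (Finset.range t).filter (· < k₀) = Finset.range k₀ := by
            ext i
            simp only [Finset.mem_filter, Finset.mem_range]
            omega
          rw [this]
          simp [mul_comm]
  have hmt := hmem t hk₀
  have := mul_le_mul_of_nonneg_left (card_memory_le K M t) hθ
  rw [hsplit]
  have := abs_add_three (∑ i ∈ memory K M t, y i)
    (∑ i ∈ replays K M t, (y (j i) - memoryMean K M y i)) (∑ i ∈ replays K M t, memoryMean K M y i)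
  linarith

/-! ### Consequences of the coverage assumption -/

/-- Starting from iteration `K`, nothing is visited during the first `M` iterations, which are replays;
hence the covering time is at least `M + 1`. -/
lemma add_one_le_card_div_of_covered {S A Ω : Type*} [Fintype S] [Nonempty S] [Fintype A]
    [Nonempty A] [MeasurableSpace Ω] {μ : Measure Ω} {K M : ℕ} {c : ℝ}
    (h : CoveredWithProbHalf (S := S) (A := A) μ (visited K M) c) :
    (M : ℝ) + 1 ≤ ((Fintype.card S * Fintype.card A : ℕ) : ℝ) / c := by
  have hK := h K
  have hne : Set.Nonempty {ω : Ω | ∀ s a, ∃ i : ℕ, K ≤ i ∧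
      (i : ℝ) + 1 ≤ K + (Fintype.card S : ℝ) * Fintype.card A / c ∧
        ω ∈ visited (S := S) (A := A) K M i s a} := by
    rw [Set.nonempty_iff_ne_empty]
    intro h0
    rw [h0, measureReal_empty] at hK
    norm_num at hK
  obtain ⟨ω, hω⟩ := hne
  obtain ⟨i, hi, hle, hvis⟩ := hω (Classical.arbitrary S) (Classical.arbitrary A)
  have hmem : i ∈ memory K M (i + 1) := hvis
  have honline : i % (K + M) < K := (Finset.mem_filter.1 hmem).2
  have hKM : K + M ≤ i := by
    by_contra hlt
    rw [Nat.mod_eq_of_lt (by omega)] at honline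
    omega
  have : (K : ℝ) + M ≤ i := by exact_mod_cast hKM
  push_cast
  linarith

/-! ### The constants -/

lemma mul_geometric_tail_le {n g δ β : ℝ} (hn : 0 < n) (hg : 1 ≤ g) (hδ : 0 < δ)
    (hβ : 1 / (32 * g) ≤ β) {k : ℕ} (hk : 32 * g * Real.log (256 * g * n / δ) ≤ k) :
    n * (4 * Real.exp (-β) ^ k / (1 - Real.exp (-β))) ≤ δ := by
  set x : ℝ := 1 / (32 * g) with hx
  have hx0 : 0 < x := by positivity
  have hx1 : x ≤ 1 := by
    rw [hx, div_le_one (by positivity)]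
    linarith
  have hle : Real.exp (-β) ≤ Real.exp (-x) := Real.exp_le_exp.2 (by linarith)
  have hden : x / 2 ≤ 1 - Real.exp (-β) := by
    have h1 : Real.exp (-x) ≤ 1 / (1 + x) := by
      rw [Real.exp_neg, ← one_div]
      exact one_div_le_one_div_of_le (by linarith) (by linarith [Real.add_one_le_exp x])
    have h2 : 1 / (1 + x) ≤ 1 - x / 2 := by
      rw [div_le_iff₀ (by linarith)]
      nlinarith
    linarith
  have hnum : Real.exp (-β) ^ k ≤ δ / (256 * g * n) := by
    calc Real.exp (-β) ^ k ≤ Real.exp (-x) ^ k := by gcongr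
      _ = Real.exp (-(k * x)) := by rw [← Real.exp_nat_mul]; ring_nf
      _ ≤ Real.exp (-Real.log (256 * g * n / δ)) := by
        rw [Real.exp_le_exp, neg_le_neg_iff, hx, ← div_eq_mul_one_div, le_div_iff₀ (by positivity)]
        linarith
      _ = δ / (256 * g * n) := by
        rw [Real.exp_neg, Real.exp_log (by positivity), inv_div]
  calc n * (4 * Real.exp (-β) ^ k / (1 - Real.exp (-β)))
      ≤ n * (4 * (δ / (256 * g * n)) / (x / 2)) := by gcongr
    _ = δ := by
      rw [hx]
      field_simp
      norm_num

/-- The time from which the averaged noise is small is of order `(x ^ 2 * L) ^ 2`: of the four factors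
`x`, two come from `k₀` and one from `v`, and the last one absorbs the logarithm of `x`. -/
lemma burnIn_le {n δ x v L : ℝ} (hn : 1 ≤ n) (hδ : 0 < δ) (hδ1 : δ < 1) (hx : 2 ≤ x)
    (hv0 : 0 ≤ v) (hv : v ≤ x) (hL : 1 / 4 ≤ L) (hnL : Real.log (n / δ) ≤ L) {k₀ t₀ : ℕ}
    (hk₀ : k₀ = ⌈32 * x ^ 2 * Real.log (256 * x ^ 2 * n / δ)⌉₊) (ht₀ : t₀ = ⌈8 * v * k₀⌉₊) :
    (t₀ : ℝ) + 1 ≤ 21730 * (x ^ 2 * L) ^ 2 := by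
  have hnδ : 1 ≤ n / δ := by
    rw [le_div_iff₀ hδ]
    linarith
  set l := Real.log (256 * x ^ 2 * n / δ) with hl
  have hsplit : l = 8 * Real.log 2 + 2 * Real.log x + Real.log (n / δ) := by
    rw [hl, mul_div_assoc, Real.log_mul (by positivity) (by positivity),
      Real.log_mul (by positivity) (by positivity), Real.log_pow]
    have : (256 : ℝ) = 2 ^ 8 := by norm_num
    rw [this, Real.log_pow]
    push_cast
    ring
  have hlog2 := Real.log_two_gt_d9
  have hlog2' := Real.log_two_lt_d9
  have hlogx : 0 ≤ Real.log x := Real.log_nonneg (by linarith)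
  have hlogx' := Real.log_le_sub_one_of_pos (show 0 < x by linarith)
  have hlogn : 0 ≤ Real.log (n / δ) := Real.log_nonneg hnδ
  have hl1 : 1 ≤ l := by linarith
  have hLL : 1 / 16 ≤ L ^ 2 := by nlinarith
  have hLn : Real.log (n / δ) ≤ 4 * L ^ 2 := by nlinarith
  have hl2 : l ≤ 82 * x * L ^ 2 := by
    have h1 : x ≤ 16 * (x * L ^ 2) := by nlinarith
    have h2 : 2 * L ^ 2 ≤ x * L ^ 2 := by nlinarith
    linarith
  have hx2 : 4 ≤ x ^ 2 := by nlinarith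
  have hx3 : 8 ≤ x ^ 3 := by
    calc (8 : ℝ) = 2 ^ 3 := by norm_num
      _ ≤ x ^ 3 := by gcongr
  have hk : (k₀ : ℝ) ≤ 33 * x ^ 2 * l := by
    have h1 := (Nat.ceil_lt_add_one (show 0 ≤ 32 * x ^ 2 * l by positivity)).le
    rw [← hk₀] at h1
    nlinarith
  have ht : (t₀ : ℝ) ≤ 8 * v * k₀ + 1 := by
    rw [ht₀]
    exact (Nat.ceil_lt_add_one (by positivity)).le
  calc (t₀ : ℝ) + 1 ≤ 8 * x * (33 * x ^ 2 * l) + 2 := by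
        have : v * k₀ ≤ x * (33 * x ^ 2 * l) := by gcongr
        linarith
    _ ≤ 265 * x ^ 3 * l := by nlinarith
    _ ≤ 265 * x ^ 3 * (82 * x * L ^ 2) := by gcongr
    _ = 21730 * (x ^ 2 * L) ^ 2 := by ring

lemma two_le_D₀_div {γ Rmax q ε₁ : ℝ} (hε : 0 < ε₁) (hεV : ε₁ ≤ Vmax γ Rmax) :
    2 ≤ D₀ γ Rmax q / ε₁ := by
  rw [le_div_iff₀ hε, D₀]
  linarith [le_max_right q (Vmax γ Rmax)]

/-- The constant is a lower bound for `2 * log 2`. All that matters below is that it exceeds `1`, which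
keeps `log N` away from `0`. -/
lemma stages_ge {γ Rmax q ε₁ : ℝ} (h0 : 0 < γ) (h1 : γ < 1) (hε : 0 < ε₁)
    (hεV : ε₁ ≤ Vmax γ Rmax) : 1.386 ≤ stages γ Rmax q ε₁ := by
  have h2 : 2 ≤ 2 / (1 - γ) := by
    rw [le_div_iff₀ (by linarith)]
    linarith
  have h3 : Real.log 2 ≤ Real.log (D₀ γ Rmax q / ε₁) :=
    Real.log_le_log (by norm_num) (two_le_D₀_div hε hεV)
  have h4 := Real.log_two_gt_d9
  unfold stages
  nlinarith

/-- After `N` stages the factor `D₀` has been contracted below `ε₁ / 2`, since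
`exp (-N) ^ (1 - γ) = (ε₁ / D₀) ^ 2`. -/
lemma D₀_mul_rpow_le {γ Rmax q ε₁ ρ : ℝ} (h1 : γ < 1) (hε : 0 < ε₁)
    (hεV : ε₁ ≤ Vmax γ Rmax) (hρ0 : 0 ≤ ρ) (hρ : ρ ≤ Real.exp (-stages γ Rmax q ε₁)) :
    D₀ γ Rmax q * ρ ^ (1 - γ) ≤ ε₁ / 2 := by
  have h2 := two_le_D₀_div (q := q) hε hεV
  have hD : 0 < D₀ γ Rmax q := by
    by_contra h
    have := div_nonpos_of_nonpos_of_nonneg (not_lt.1 h) hε.le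
    linarith
  have h3 : ρ ^ (1 - γ) ≤ (ε₁ / D₀ γ Rmax q) ^ 2 := by
    calc ρ ^ (1 - γ) ≤ Real.exp (-stages γ Rmax q ε₁) ^ (1 - γ) :=
          Real.rpow_le_rpow hρ0 hρ (by linarith)
      _ = Real.exp (-(2 * Real.log (D₀ γ Rmax q / ε₁))) := by
        rw [← Real.exp_mul, stages]
        congr 1
        have : 1 - γ ≠ 0 := by linarith
        field_simp
      _ = (ε₁ / D₀ γ Rmax q) ^ 2 := by
        rw [Real.exp_neg, two_mul, Real.exp_add, Real.exp_log (by positivity), ← sq, ← inv_pow,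
          inv_div]
  calc D₀ γ Rmax q * ρ ^ (1 - γ) ≤ D₀ γ Rmax q * (ε₁ / D₀ γ Rmax q) ^ 2 := by gcongr
    _ = ε₁ / (D₀ γ Rmax q / ε₁) := by field_simp
    _ ≤ ε₁ / 2 := by gcongr

lemma quarter_le_log {n N δ : ℝ} (hn : 1 ≤ n) (hN : 1.386 ≤ N) (hδ : 0 < δ) (hδ1 : δ < 1) :
    1 / 4 ≤ Real.log (n * N / δ) ∧ Real.log (n / δ) ≤ Real.log (n * N / δ) := by
  have hnδ : 1 ≤ n / δ := by
    rw [le_div_iff₀ hδ]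
    linarith
  have hN0 : 0 < N := by linarith
  have hsplit : Real.log (n * N / δ) = Real.log N + Real.log (n / δ) := by
    rw [← Real.log_mul (by positivity) (by positivity)]
    congr 1
    ring
  have h1 := Real.one_sub_inv_le_log_of_pos hN0
  have h2 : N⁻¹ ≤ 3 / 4 := by
    rw [inv_le_comm₀ hN0 (by norm_num)]
    norm_num
    linarith
  have h3 : 0 ≤ Real.log (n / δ) := Real.log_nonneg hnδ
  exact ⟨by linarith, by linarith⟩

/-- Since `max M K ≥ (M + K) / 2`, the quantity `B` is at least `3 ^ N * (g * L) / 2`, where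
`g = (n / c) * (V / η) ^ 2` and `η = ε₁ * (1 - γ) / 2`. -/
lemma le_boundB {n M K : ℕ} {γ c Rmax q ε₁ δ η : ℝ} (hK : 0 < K) (h1 : γ < 1) (hc : 0 < c)
    (hε : 0 < ε₁) (hη : η = ε₁ * (1 - γ) / 2)
    (hL : 0 ≤ Real.log (n * stages γ Rmax q ε₁ / δ)) :
    (3 : ℝ) ^ stages γ Rmax q ε₁ *
      ((n / c * (Vmax γ Rmax / η) ^ 2) * Real.log (n * stages γ Rmax q ε₁ / δ)) / 2 ≤
      boundB n M K γ c Rmax q ε₁ δ := by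
  have hK' : (0 : ℝ) < K := by exact_mod_cast hK
  have h1' : 0 < 1 - γ := by linarith
  have hη0 : 0 < η := by rw [hη]; positivity
  have hmax : ((M : ℝ) + K) / 2 ≤ max (M : ℝ) K := by
    linarith [le_max_left (M : ℝ) K, le_max_right (M : ℝ) K]
  have hMK : 1 / 2 ≤ max (M : ℝ) K / (M + K) := by
    rw [le_div_iff₀ (by positivity)]
    linarith
  set L := Real.log (n * stages γ Rmax q ε₁ / δ)
  have hB : boundB n M K γ c Rmax q ε₁ δ = (3 : ℝ) ^ stages γ Rmax q ε₁ *
      ((n / c * (Vmax γ Rmax / η) ^ 2) * L) * (max (M : ℝ) K / (M + K)) := by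
    rw [boundB, Vmax_eq h1, hη]
    field_simp
    rfl
  rw [hB, div_eq_mul_one_div]
  gcongr

lemma boundC_eq (n M K : ℕ) (γ c Rmax q ε₁ δ : ℝ) :
    boundC n M K γ c Rmax q ε₁ δ = boundB n M K γ c Rmax q ε₁ δ * Real.logb 2 (1 / δ) := by
  rw [boundC, boundB]
  ring

/-- The constants fit: there are burn-in times `k₀`, for the deviations, and `t₀`, for the averaged
noise, that are long enough for the failure probability `δ` and leave the time for `N` stages. -/
lemma exists_burnIn {n M K : ℕ} {γ c Rmax q ε₁ δ η T β : ℝ} (hn1 : (1 : ℝ) ≤ n) (hK : 0 < K)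
    (h0 : 0 < γ) (h1 : γ < 1) (hc : 0 < c) (hδ : 0 < δ) (hδ1 : δ < 1) (hε : 0 < ε₁)
    (hεV : ε₁ ≤ Vmax γ Rmax) (hη : η = ε₁ * (1 - γ) / 2) (hcover : (M : ℝ) + 1 ≤ n / c)
    (hβ : β = (η / 4) ^ 2 / (2 * (M + 1) * Vmax γ Rmax ^ 2))
    (hT : 100000 * (boundB n M K γ c Rmax q ε₁ δ ^ 2 +
      Real.sqrt (boundB n M K γ c Rmax q ε₁ δ ^ 4 +
        boundB n M K γ c Rmax q ε₁ δ ^ 2 * boundC n M K γ c Rmax q ε₁ δ) +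
      boundC n M K γ c Rmax q ε₁ δ) ≤ T) :
    ∃ k₀ t₀ : ℕ, 0 < k₀ ∧ 8 * (Vmax γ Rmax / η) * k₀ ≤ t₀ ∧
      Real.exp (stages γ Rmax q ε₁) * (t₀ + 1) ≤ T ∧
      n * (4 * Real.exp (-β) ^ k₀ / (1 - Real.exp (-β))) ≤ δ := by
  set V := Vmax γ Rmax with hVdef
  set N := stages γ Rmax q ε₁ with hNdef
  have h1' : 0 < 1 - γ := by linarith
  have hη0 : 0 < η := by rw [hη]; positivity
  have hV : 0 < V := hε.trans_le hεV
  have hN : 1.386 ≤ N := stages_ge h0 h1 hε hεV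
  obtain ⟨hL, hnL⟩ := quarter_le_log hn1 hN hδ hδ1
  set L := Real.log (n * N / δ) with hLdef
  have hnc : 1 ≤ (n : ℝ) / c := by linarith [(Nat.cast_nonneg M : (0 : ℝ) ≤ M)]
  have hv : 2 ≤ V / η := by
    rw [le_div_iff₀ hη0, hη]
    nlinarith
  set g := (n : ℝ) / c * (V / η) ^ 2 with hg
  have hvg : (V / η) ^ 2 ≤ g := le_mul_of_one_le_left (by positivity) hnc
  have hg4 : 4 ≤ g := by nlinarith
  set x := Real.sqrt g with hx
  have hxg : x ^ 2 = g := Real.sq_sqrt (by linarith)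
  have hvx : V / η ≤ x := Real.le_sqrt_of_sq_le hvg
  obtain ⟨k₀, hk₀⟩ : ∃ k₀ : ℕ, k₀ = ⌈32 * x ^ 2 * Real.log (256 * x ^ 2 * n / δ)⌉₊ := ⟨_, rfl⟩
  obtain ⟨t₀, ht₀⟩ : ∃ t₀ : ℕ, t₀ = ⌈8 * (V / η) * k₀⌉₊ := ⟨_, rfl⟩
  have hburn := burnIn_le hn1 hδ hδ1 (hv.trans hvx) (by positivity) hvx hL hnL hk₀ ht₀
  rw [hxg] at hk₀ hburn
  have hk₀pos : 0 < k₀ := by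
    rw [hk₀, Nat.ceil_pos]
    have : 0 < Real.log (256 * g * n / δ) := by
      refine Real.log_pos ?_
      rw [lt_div_iff₀ hδ]
      nlinarith
    positivity
  have hk₀le : 32 * g * Real.log (256 * g * n / δ) ≤ k₀ := by
    rw [hk₀]
    exact Nat.le_ceil _
  have ht₀le : 8 * (V / η) * k₀ ≤ t₀ := by
    rw [ht₀]
    exact Nat.le_ceil _
  refine ⟨k₀, t₀, hk₀pos, ht₀le, ?_, mul_geometric_tail_le (g := g) (by linarith) (by linarith) hδ
    ?_ hk₀le⟩
  · have hB := le_boundB (M := M) (q := q) (Rmax := Rmax) (δ := δ) (n := n) hK h1 hc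
      hε hη (by rw [← hNdef, ← hLdef]; linarith)
    have hC := boundC_eq n M K γ c Rmax q ε₁ δ
    rw [← hNdef, ← hLdef, ← hVdef, ← hg] at hB
    set B := boundB n M K γ c Rmax q ε₁ δ
    have hgL : 0 ≤ g * L := mul_nonneg (by linarith) (by linarith)
    have hB0 : 0 ≤ B := le_trans (by positivity) hB
    have hC0 : 0 ≤ boundC n M K γ c Rmax q ε₁ δ := by
      rw [hC]
      refine mul_nonneg hB0 (Real.logb_nonneg (by norm_num) ?_)
      rw [le_div_iff₀ hδ]
      linarith
    have hexp : Real.exp N ≤ ((3 : ℝ) ^ N) ^ 2 := by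
      have h3 : Real.exp N ≤ (3 : ℝ) ^ N := by
        rw [← Real.exp_one_rpow]
        exact Real.rpow_le_rpow (Real.exp_pos _).le (by linarith [Real.exp_one_lt_d9])
          (by linarith)
      have h4 : 1 ≤ (3 : ℝ) ^ N := Real.one_le_rpow (by norm_num) (by linarith)
      exact h3.trans (le_self_pow₀ h4 two_ne_zero)
    have hB2 : ((3 : ℝ) ^ N) ^ 2 * (g * L) ^ 2 / 4 ≤ B ^ 2 := by
      calc _ = ((3 : ℝ) ^ N * (g * L) / 2) ^ 2 := by ring
        _ ≤ B ^ 2 := by gcongr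
    -- The numerical constant of the claim only has to exceed `4 * 21730`.
    calc Real.exp N * (t₀ + 1) ≤ ((3 : ℝ) ^ N) ^ 2 * (21730 * (g * L) ^ 2) := by gcongr
      _ ≤ 100000 * B ^ 2 := by
        have : 0 ≤ ((3 : ℝ) ^ N) ^ 2 * (g * L) ^ 2 := by positivity
        linarith
      _ ≤ T := by
        refine le_trans ?_ hT
        have := Real.sqrt_nonneg (B ^ 4 + B ^ 2 * boundC n M K γ c Rmax q ε₁ δ)
        linarith
  · -- `1 / (32 * g)` is the exponent of the deviation bound with `M + 1` enlarged to `n / c`.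
    have hexpand : (η / 4) ^ 2 / (2 * (M + 1) * V ^ 2) =
        1 / (32 * ((M + 1) * (V / η) ^ 2)) := by
      field_simp
      norm_num
    rw [hβ, hexpand]
    gcongr
    exact mul_le_mul_of_nonneg_right hcover (sq_nonneg _)

/-! ### The error of the Q-values -/

section

variable {S A : Type*} [Fintype S] [MeasurableSpace S] [MeasurableSingletonClass S]
  {D : MDP S A} {γ Rmax : ℝ}

/-- The centred update target of the pair `(s, a)`, computed from the sample `x` with the optimal
Q-values in place of the current ones. -/
noncomputable def noise (D : MDP S A) (γ : ℝ) (s : S) (a : A) (x : ℝ × S) : ℝ :=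
  x.1 + γ * (⨆ a', D.optQ γ x.2 a') - D.optQ γ s a

lemma measurable_noise (s : S) (a : A) : Measurable (noise D γ s a) := by
  unfold noise
  have h : Measurable fun s' : S => ⨆ a', D.optQ γ s' a' := Measurable.of_discrete
  exact ((measurable_fst.add ((h.comp measurable_snd).const_mul γ))).sub_const _

variable [Nonempty S] [Fintype A] [Nonempty A]

lemma noise_mem_Icc (hr : ∀ s a, ∀ᵐ x ∂(D.law s a), |x.1| ≤ Rmax) (h0 : 0 < γ) (h1 : γ < 1)
    (s : S) (a : A) {x : ℝ × S} (hx : |x.1| ≤ Rmax) :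
    noise D γ s a x ∈ Set.Icc (-Vmax γ Rmax - D.optQ γ s a)
      (-Vmax γ Rmax - D.optQ γ s a + 2 * Vmax γ Rmax) := by
  have h2 : |γ * ⨆ a', D.optQ γ x.2 a'| ≤ γ * Vmax γ Rmax := by
    rw [abs_mul, abs_of_pos h0]
    exact mul_le_mul_of_nonneg_left (abs_iSup_le fun a' => D.abs_optQ_le hr h0 h1 _ a') h0.le
  have h3 := Vmax_eq (γ := γ) (Rmax := Rmax) h1
  rw [abs_le] at hx h2
  rw [noise]
  constructor <;> linarith

lemma abs_noise_le (hr : ∀ s a, ∀ᵐ x ∂(D.law s a), |x.1| ≤ Rmax) (h0 : 0 < γ) (h1 : γ < 1)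
    (s : S) (a : A) {x : ℝ × S} (hx : |x.1| ≤ Rmax) :
    |noise D γ s a x| ≤ 2 * Vmax γ Rmax := by
  have h2 := noise_mem_Icc hr h0 h1 s a hx
  have h3 := abs_le.1 (D.abs_optQ_le hr h0 h1 s a)
  rw [Set.mem_Icc] at h2
  exact abs_le.2 ⟨by linarith, by linarith⟩

/-- By the Bellman equation, the noise is centred. -/
lemma integral_noise (hr : ∀ s a, ∀ᵐ x ∂(D.law s a), |x.1| ≤ Rmax) (h0 : 0 < γ) (h1 : γ < 1)
    (s : S) (a : A) : ∫ x, noise D γ s a x ∂(D.law s a) = 0 := by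
  have := D.isProb s a
  have hint : Integrable (fun x : ℝ × S => γ * ⨆ a', D.optQ γ x.2 a') (D.law s a) := by
    have h : Measurable fun s' : S => ⨆ a', D.optQ γ s' a' := Measurable.of_discrete
    refine (Integrable.of_bound (h.comp measurable_snd).aestronglyMeasurable (Vmax γ Rmax)
      (ae_of_all _ fun x => ?_)).const_mul γ
    exact abs_iSup_le fun a' => D.abs_optQ_le hr h0 h1 _ a'
  have hadd : Integrable (fun x : ℝ × S => x.1 + γ * ⨆ a', D.optQ γ x.2 a') (D.law s a) :=
    (D.integrable_fst (hr s a)).add hint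
  unfold noise
  rw [integral_sub hadd (integrable_const _),
    integral_add (D.integrable_fst (hr s a)) hint, integral_const_mul,
    D.integral_comp_snd s a fun s' => ⨆ a', D.optQ γ s' a', integral_const]
  simp only [probReal_univ, one_smul]
  rw [D.optQ_eq hr h0 h1 s a, MDP.R, sub_self]

/-- On a sample path whose averaged noise stays below `η = ε₁ * (1 - γ) / 2` from time `t₀` on, the
error stays below `ε₁` from time `exp N * (t₀ + 1)` on. -/
lemma norm_qValues_sub_optQ_le (hr : ∀ s a, ∀ᵐ x ∂(D.law s a), |x.1| ≤ Rmax) (h0 : 0 < γ)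
    (h1 : γ < 1) {ε₁ η : ℝ} (hε : 0 < ε₁) (hεV : ε₁ ≤ Vmax γ Rmax)
    (hη : η = ε₁ * (1 - γ) / 2) (Q₀ : S → A → ℝ) {z : ℕ → S → A → ℝ × S}
    (hz : ∀ i s a, |(z i s a).1| ≤ Rmax) {t₀ : ℕ} (ht₀ : 0 < t₀)
    (hnoise : ∀ t, t₀ ≤ t → ∀ s a, |∑ i ∈ Finset.range t, noise D γ s a (z i s a)| ≤ t * η)
    {t : ℕ} (ht : Real.exp (stages γ Rmax ‖Q₀‖ ε₁) * (t₀ + 1) ≤ t) :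
    ‖qValues γ Q₀ z t - D.optQ γ‖ ≤ ε₁ := by
  have h1' : 0 < 1 - γ := by linarith
  have hη0 : 0 < η := by rw [hη]; positivity
  have hV : 0 < Vmax γ Rmax := hε.trans_le hεV
  have hexp : 1 ≤ Real.exp (stages γ Rmax ‖Q₀‖ ε₁) :=
    Real.one_le_exp (by linarith [stages_ge (q := ‖Q₀‖) h0 h1 hε hεV])
  have ht₀t : t₀ ≤ t := by
    have : (t₀ : ℝ) ≤ t := by nlinarith [(Nat.cast_nonneg t₀ : (0 : ℝ) ≤ t₀)]
    exact_mod_cast this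
  have hD : ∀ t, ‖qValues γ Q₀ z t - D.optQ γ‖ ≤ D₀ γ Rmax ‖Q₀‖ := by
    intro t
    refine norm_le_of_forall_abs_le (by rw [D₀]; positivity) fun s a => ?_
    refine (abs_sub _ _).trans ?_
    rw [D₀]
    linarith [abs_qValues_le h0 h1 Q₀ hz t s a, D.abs_optQ_le hr h0 h1 s a]
  have hmain := le_of_averaged_contraction h0 h1 ((norm_nonneg _).trans (hD 0)) hD ht₀ hη0.le
    (fun t ht => mul_norm_qValues_sub_le h0 hη0.le Q₀ (D.optQ γ) z t (hnoise t ht)) t ht₀t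
  have hρ : ((t₀ : ℝ) + 1) / (t + 1) ≤ Real.exp (-stages γ Rmax ‖Q₀‖ ε₁) := by
    rw [Real.exp_neg, div_le_iff₀ (by positivity), ← div_eq_inv_mul, le_div_iff₀ (by positivity)]
    linarith
  have hdecay := D₀_mul_rpow_le h1 hε hεV (by positivity) hρ
  have : η / (1 - γ) = ε₁ / 2 := by
    rw [hη]
    field_simp
  linarith

/-- The pathwise bound and the deviation bound combined, by a union bound over the state-action pairs,
for burn-in times `k₀` and `t₀` that are long enough. -/
lemma le_measureReal_forall_norm_syncQ_sub_le {Ω : Type*} [MeasurableSpace Ω] {μ : Measure Ω}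
    [IsProbabilityMeasure μ] {K M : ℕ} {ε₁ η δ : ℝ} {X : ℕ → S → A → Ω → ℝ × S}
    {J : ℕ → S → A → Ω → ℕ} (Q₀ : S → A → ℝ) (hK : 0 < K) (h0 : 0 < γ) (h1 : γ < 1)
    (hε : 0 < ε₁) (hεV : ε₁ ≤ Vmax γ Rmax) (hη : η = ε₁ * (1 - γ) / 2)
    (hr : ∀ s a, ∀ᵐ x ∂(D.law s a), |x.1| ≤ Rmax) (hX : IsSampling D K M μ X J)
    {k₀ t₀ T : ℕ} (hk₀ : 0 < k₀) (ht₀ : 8 * (Vmax γ Rmax / η) * k₀ ≤ t₀)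
    (hT : Real.exp (stages γ Rmax ‖Q₀‖ ε₁) * (t₀ + 1) ≤ T) {β : ℝ}
    (hβ : β = (η / 4) ^ 2 / (2 * (M + 1) * Vmax γ Rmax ^ 2))
    (htail : ((Fintype.card S * Fintype.card A : ℕ) : ℝ) *
      (4 * Real.exp (-β) ^ k₀ / (1 - Real.exp (-β))) ≤ δ) :
    1 - δ ≤ μ.real {ω | ∀ t : ℕ, T ≤ t → ‖syncQ γ K M Q₀ X J t ω - D.optQ γ‖ ≤ ε₁} := by
  have h1' : 0 < 1 - γ := by linarith
  have hη0 : 0 < η := by rw [hη]; positivity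
  have hV : 0 < Vmax γ Rmax := hε.trans_le hεV
  have hηV : η ≤ Vmax γ Rmax := by
    refine le_trans ?_ hεV
    rw [hη]
    nlinarith
  have hk₀t₀ : k₀ ≤ t₀ := by
    have h2 : 1 ≤ Vmax γ Rmax / η := (one_le_div hη0).2 hηV
    have : (k₀ : ℝ) ≤ t₀ := by nlinarith [(Nat.cast_nonneg k₀ : (0 : ℝ) ≤ k₀)]
    exact_mod_cast this
  set θ := η / 4 with hθ
  have hθ0 : 0 < θ := by positivity
  let Y : S → A → ℕ → Ω → ℝ := fun s a k ω => noise D γ s a (X k s a ω)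
  have hreward : ∀ k s a, ∀ᵐ ω ∂μ, |(X k s a ω).1| ≤ Rmax := fun k s a =>
    ae_of_ae_map (hX.measurable_X k s a).aemeasurable (by rw [hX.law_X]; exact hr s a)
  let bad : S × A → Set Ω := fun p => {ω | ∃ k, k₀ ≤ k ∧
    (θ * (memory K M k).card ≤ |∑ j ∈ memory K M k, Y p.1 p.2 j ω| ∨
      θ * k ≤ |∑ i ∈ replays K M k,
        (Y p.1 p.2 (J i p.1 p.2 ω) ω - memoryMean K M (fun j => Y p.1 p.2 j ω) i)|)}
  have hbad : ∀ p, μ (bad p) ≤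
      ENNReal.ofReal (4 * Real.exp (-β) ^ k₀ / (1 - Real.exp (-β))) := by
    rintro ⟨s, a⟩
    have hinj : Function.Injective fun k : ℕ => (k, s, a) := fun k l h => (Prod.mk.inj h).1
    refine measure_exists_deviation_le (a := -Vmax γ Rmax - D.optQ γ s a) (V := Vmax γ Rmax) hK
      (fun k => (measurable_noise s a).comp (hX.measurable_X k s a))
      (fun k => hX.measurable_J k s a) (fun k hk => hX.law_J k hk s a)
      ((hX.indep.precomp hinj).comp (fun _ p => (noise D γ s a p.1, p.2)) fun _ =>
        ((measurable_noise s a).comp measurable_fst).prodMk measurable_snd)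
      (fun k => (hX.indep_XJ k s a).comp (measurable_noise s a) measurable_id) hV
      (fun k => (hreward k s a).mono fun ω hω => noise_mem_Icc hr h0 h1 s a hω)
      (fun k => ?_) hθ0 hk₀ (by rw [hβ])
    rw [← integral_noise hr h0 h1 s a, ← hX.law_X k s a,
      integral_map (hX.measurable_X k s a).aemeasurable (measurable_noise s a).aestronglyMeasurable]
    rfl
  have hgood : ∀ᵐ ω ∂μ, ω ∈ {ω | ∀ t : ℕ, T ≤ t → ‖syncQ γ K M Q₀ X J t ω - D.optQ γ‖ ≤ ε₁}ᶜ →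
      ω ∈ ⋃ p, bad p := by
    filter_upwards [ae_all_iff.2 fun k => ae_all_iff.2 fun s => ae_all_iff.2 fun a =>
      hreward k s a] with ω hω
    contrapose
    rw [Set.notMem_compl_iff]
    intro hωbad t ht
    simp only [Set.mem_iUnion, not_exists] at hωbad
    refine norm_qValues_sub_optQ_le hr h0 h1 hε hεV hη Q₀
      (fun i s a => ?_) (hk₀.trans_le hk₀t₀) (fun t ht s a => ?_)
      (hT.trans (by exact_mod_cast ht))
    · unfold experience
      split_ifs
      exacts [hω _ _ _, hω _ _ _]
    · have hωbad' := hωbad (s, a)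
      simp only [bad, Set.mem_ofPred_eq, not_exists, not_and, not_or, not_le] at hωbad'
      have hlarge : 2 * Vmax γ Rmax * k₀ ≤ θ * t := by
        have h2 : 8 * (Vmax γ Rmax / η) * k₀ ≤ t := ht₀.trans (by exact_mod_cast ht)
        have h3 := mul_le_mul_of_nonneg_left h2 hθ0.le
        have h4 : θ * (8 * (Vmax γ Rmax / η) * k₀) = 2 * Vmax γ Rmax * k₀ := by
          rw [hθ]
          field_simp
          norm_num
        linarith
      have h5 := abs_sum_experience_le (y := fun j => Y s a j ω) (j := fun i => J i s a ω) hθ0.le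
        (by positivity) (fun i => abs_noise_le hr h0 h1 s a (hω i s a)) (hk₀t₀.trans ht) hlarge
        (fun k hk => (hωbad' k hk).1.le) (hωbad' t (hk₀t₀.trans ht)).2.le
      have h6 : 4 * θ = η := by rw [hθ]; ring
      rw [h6] at h5
      convert h5 using 4 with i
      unfold experience
      split_ifs <;> rfl
  have hcompl : μ.real {ω | ∀ t : ℕ, T ≤ t → ‖syncQ γ K M Q₀ X J t ω - D.optQ γ‖ ≤ ε₁}ᶜ ≤ δ := by
    have hδ0 : 0 ≤ δ := by
      refine le_trans ?_ htail
      have : Real.exp (-β) ≤ 1 := Real.exp_le_one_iff.2 (by rw [hβ, neg_nonpos]; positivity)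
      have : 0 ≤ 1 - Real.exp (-β) := by linarith
      positivity
    refine ENNReal.toReal_le_of_le_ofReal hδ0 ((measure_mono_ae hgood).trans ?_)
    calc μ (⋃ p, bad p) ≤ ∑ p : S × A, μ (bad p) := measure_iUnion_fintype_le _ _
      _ ≤ ∑ _p : S × A, ENNReal.ofReal (4 * Real.exp (-β) ^ k₀ / (1 - Real.exp (-β))) :=
        Finset.sum_le_sum fun p _ => hbad p
      _ = ENNReal.ofReal (((Fintype.card S * Fintype.card A : ℕ) : ℝ) *
          (4 * Real.exp (-β) ^ k₀ / (1 - Real.exp (-β)))) := by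
        rw [Finset.sum_const, Finset.card_univ, Fintype.card_prod, nsmul_eq_mul,
          ENNReal.ofReal_mul (Nat.cast_nonneg _), ENNReal.ofReal_natCast]
      _ ≤ ENNReal.ofReal δ := ENNReal.ofReal_le_ofReal htail
  have hunion := measureReal_union_le (μ := μ)
    {ω | ∀ t : ℕ, T ≤ t → ‖syncQ γ K M Q₀ X J t ω - D.optQ γ‖ ≤ ε₁}
    {ω | ∀ t : ℕ, T ≤ t → ‖syncQ γ K M Q₀ X J t ω - D.optQ γ‖ ≤ ε₁}ᶜ
  rw [Set.union_compl_self, probReal_univ] at hunion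
  linarith

end

end SyncReplay

theorem mainTheorem5 :
    ∃ κ : ℝ, 0 < κ ∧
      ∀ (S A Ω : Type*) [Fintype S] [Nonempty S] [Fintype A] [Nonempty A]
        [MeasurableSpace S] [MeasurableSingletonClass S] [MeasurableSpace Ω]
        (μ : Measure Ω) [IsProbabilityMeasure μ]
        (D : SyncReplay.MDP S A) (K M : ℕ) (γ c Rmax ε₁ δ : ℝ) (Q₀ : S → A → ℝ)
        (X : ℕ → S → A → Ω → ℝ × S) (J : ℕ → S → A → Ω → ℕ) (T : ℕ),
        0 < K → 0 < γ → γ < 1 → 0 < c → c < 1 → 0 < δ → δ < 1 →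
        0 < ε₁ → ε₁ ≤ SyncReplay.Vmax γ Rmax →
        (∀ s a, ∀ᵐ x ∂(D.law s a), |x.1| ≤ Rmax) →
        SyncReplay.IsSampling D K M μ X J →
        SyncReplay.CoveredWithProbHalf (S := S) (A := A) μ (SyncReplay.visited K M) c →
        (let B := SyncReplay.boundB (Fintype.card S * Fintype.card A) M K γ c Rmax ‖Q₀‖ ε₁ δ
         let C := SyncReplay.boundC (Fintype.card S * Fintype.card A) M K γ c Rmax ‖Q₀‖ ε₁ δ
         κ * (B ^ 2 + Real.sqrt (B ^ 4 + B ^ 2 * C) + C) ≤ (T : ℝ)) →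
        1 - δ ≤ μ.real {ω | ∀ t : ℕ, T ≤ t →
          ‖SyncReplay.syncQ γ K M Q₀ X J t ω - D.optQ γ‖ ≤ ε₁} := by
  refine ⟨100000, by norm_num, ?_⟩
  intro S A Ω _ _ _ _ _ _ _ μ _ D K M γ c Rmax ε₁ δ Q₀ X J T hK h0 h1 hc _ hδ hδ1 hε hεV hr hX
    hcov hT
  have hn1 : (1 : ℝ) ≤ (Fintype.card S * Fintype.card A : ℕ) := by
    exact_mod_cast Nat.mul_pos (Fintype.card_pos (α := S)) (Fintype.card_pos (α := A))
  obtain ⟨k₀, t₀, hk₀, ht₀, hstages, htail⟩ := SyncReplay.exists_burnIn hn1 hK h0 h1 hc hδ hδ1 hε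
    hεV rfl (SyncReplay.add_one_le_card_div_of_covered hcov) rfl hT
  exact SyncReplay.le_measureReal_forall_norm_syncQ_sub_le Q₀ hK h0 h1 hε hεV rfl hr hX hk₀ ht₀
    hstages rfl htail
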